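/- Let $k$ be a commutative artinian ring, let $A$ be a hereditary artin $k$-algebra, and let $D=\operatorname{Hom}_k(-,E)$ be the standard duality, where $E$ is an injective envelope of $k/\operatorname{rad}k$. All modules are right modules, and $\operatorname{mod}$ denotes the category of finitely generated ones. For an integer $m\ge 0$ let $A^{(m)}$ be the $m$-replicated algebra of $A$, that is, the algebra of lower triangular $(m+1)\times(m+1)$ matrices, rows and columns numbered $0,\dots,m$, with entries in $A_i=A$ at the positions $(i,i)$ for $0\le i\le m$, entries in $Q_i=DA$ at the positions $(i,i-1)$ for $1\le i\le m$, and zeros elsewhere; the multiplication is matrix multiplication, given by the multiplication of $A$, the $A$-$A$-bimodule structure of $DA$, and the zero map $DA\otimes_A DA\to 0$. For each $i$, an $A$-module is regarded as an $A^{(m)}$-module through the projection $A^{(m)}\to A_i=A$ whenever it is called an $A_i$-module; $A$-modules are regarded as $A_0$-modules, and $DA_m$ denotes $DA$ as an $A_m$-module. Lemma 4.8. Let $N$ be a finitely generated indecomposable $A$-module whose endomorphism ring is a division ring and for which there is a non-split short exact sequence of $A$-modules $$0\longrightarrow N\stackrel{u}{\longrightarrow}N'\stackrel{v}{\longrightarrow}N\longrightarrow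 0 .$$ Let $P$ be the direct sum of all indecomposable projective-injective modules in $\operatorname{mod}A^{(m)}$, one from each isomorphism class, and let $$M=A\oplus DA_m\oplus P\oplus N' .$$ Then $M$ is a generator-cogenerator in $\operatorname{mod}A^{(m)}$, that is, $M$ is finitely generated and every indecomposable projective and every indecomposable injective module in $\operatorname{mod}A^{(m)}$ is a direct summand of a finite direct sum of copies of $M$; and $\operatorname{gl.dim}\operatorname{End}_{A^{(m)}}(M)=\infty$. -/

import Mathlib

universe u

open scoped DirectSum

/-! Right modules over a ring `R` are modules over `Rᵐᵒᵖ`. -/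

section RightModules

/-- `A` is right hereditary: every right ideal of `A` is projective. -/
def IsHereditaryRing (A : Type u) [Ring A] : Prop :=
  ∀ I : Submodule Aᵐᵒᵖ A, Module.Projective Aᵐᵒᵖ I

/-- `A` is an artin algebra over `k`: `k` is a commutative artinian ring and `A` is finitely
generated as a `k`-module. -/
structure IsArtinAlgebra (k A : Type u) [CommRing k] [Ring A] [Algebra k A] : Prop where
  isArtinianRing : IsArtinianRing k
  finite : Module.Finite k A

/-- A module is indecomposable if it is nonzero and is not an internal direct sum of two nonzero
submodules. -/
def IsIndecomposableModule (S : Type u) [Ring S] (X : Type u) [AddCommGroup X] [Module S X] :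
    Prop :=
  Nontrivial X ∧ ∀ U V : Submodule S X, IsCompl U V → U = ⊥ ∨ V = ⊥

/-- `X ∈ add M`: `X` is a direct summand of a finite direct sum of copies of `M`. -/
def InAdd (S : Type u) [Ring S] (M X : Type u) [AddCommGroup M] [Module S M]
    [AddCommGroup X] [Module S X] : Prop :=
  ∃ (n : ℕ) (i : X →ₗ[S] (Fin n → M)) (r : (Fin n → M) →ₗ[S] X), r ∘ₗ i = LinearMap.id

/-- The right `R`-module `M` is a generator-cogenerator in `mod R`: it is finitely generated, and
`add M` contains all indecomposable projective and all indecomposable injective modules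
of `mod R`. -/
structure IsGeneratorCogenerator (R : Type u) [Ring R] (M : Type u) [AddCommGroup M]
    [Module Rᵐᵒᵖ M] : Prop where
  finite : Module.Finite Rᵐᵒᵖ M
  generator : ∀ (X : Type u) [AddCommGroup X] [Module Rᵐᵒᵖ X], Module.Finite Rᵐᵒᵖ X →
    IsIndecomposableModule Rᵐᵒᵖ X → Module.Projective Rᵐᵒᵖ X → InAdd Rᵐᵒᵖ M X
  cogenerator : ∀ (X : Type u) [AddCommGroup X] [Module Rᵐᵒᵖ X], Module.Finite Rᵐᵒᵖ X →
    IsIndecomposableModule Rᵐᵒᵖ X → Module.Injective Rᵐᵒᵖ X → InAdd Rᵐᵒᵖ M X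

/-- The (right) global dimension of `R`: the supremum of the projective dimensions of all right
`R`-modules. -/
noncomputable def globalDimension (R : Type u) [Ring R] : WithBot ℕ∞ :=
  ⨆ X : ModuleCat.{u} Rᵐᵒᵖ, CategoryTheory.projectiveDimension X

end RightModules

section ProjectiveInjective

variable (R : Type u) [Ring R]

/-- Presentations of finitely generated right `R`-modules: a number `n` and a submodule of the
free right module `R ^ n`. -/
abbrev FGPresentation : Type u := Σ n : ℕ, Submodule Rᵐᵒᵖ (Fin n → R)

/-- The module presented by `x`. Every finitely generated right `R`-module is isomorphic to one of
this form. -/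
abbrev FGPresentation.Carrier {R : Type u} [Ring R] (x : FGPresentation R) : Type u :=
  (Fin x.1 → R) ⧸ x.2

/-- Presentations of the indecomposable projective-injective modules in `mod R`. -/
def IndecProjInj : Type u :=
  {x : FGPresentation R // IsIndecomposableModule Rᵐᵒᵖ x.Carrier ∧
    Module.Projective Rᵐᵒᵖ x.Carrier ∧ Module.Injective Rᵐᵒᵖ x.Carrier}

/-- Isomorphism of the presented modules. -/
instance IndecProjInj.isoSetoid : Setoid (IndecProjInj R) where
  r x y := Nonempty (x.1.Carrier ≃ₗ[Rᵐᵒᵖ] y.1.Carrier)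
  iseqv :=
    { refl := fun _ => ⟨LinearEquiv.refl _ _⟩
      symm := fun ⟨e⟩ => ⟨e.symm⟩
      trans := fun ⟨e⟩ ⟨f⟩ => ⟨e.trans f⟩ }

/-- The direct sum of all indecomposable projective-injective modules in `mod R`, one from each
isomorphism class. -/
def SumProjInj : Type u :=
  ⨁ c : Quotient (IndecProjInj.isoSetoid R), (Quotient.out c).1.Carrier

noncomputable instance : AddCommGroup (SumProjInj R) :=
  inferInstanceAs (AddCommGroup
    (⨁ c : Quotient (IndecProjInj.isoSetoid R), (Quotient.out c).1.Carrier))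

noncomputable instance : Module Rᵐᵒᵖ (SumProjInj R) :=
  inferInstanceAs (Module Rᵐᵒᵖ
    (⨁ c : Quotient (IndecProjInj.isoSetoid R), (Quotient.out c).1.Carrier))

end ProjectiveInjective

section InjectiveEnvelope

variable {R : Type u} [CommRing R]

/-- `f : X → E` is an injective envelope: `E` is injective, `f` is injective, and `E` is an
essential extension of the image of `f`. -/
structure IsInjectiveEnvelope {X E : Type u} [AddCommGroup X] [Module R X] [AddCommGroup E]
    [Module R E] (f : X →ₗ[R] E) : Prop where
  injective : Module.Injective R E
  injective_map : Function.Injective f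
  essential : ∀ U : Submodule R E, U ⊓ LinearMap.range f = ⊥ → U = ⊥

theorem exists_isInjectiveEnvelope (R : Type u) [CommRing R] (X : Type u) [AddCommGroup X]
    [Module R X] :
    ∃ (E : ModuleCat.{u} R) (f : X →ₗ[R] E), IsInjectiveEnvelope f := by
  obtain ⟨I, _, _, hI, g, hg⟩ : ∃ (I : Type u) (_ : AddCommGroup I) (_ : Module R I)
      (_ : Module.Injective R I) (g : X →ₗ[R] I), Function.Injective g := by
    let J : ModuleCat.{u} R := CategoryTheory.Injective.under (ModuleCat.of R X)
    have : CategoryTheory.Injective (ModuleCat.of R J) :=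
      inferInstanceAs (CategoryTheory.Injective J)
    exact ⟨J, inferInstance, inferInstance, Module.injective_module_of_injective_object R J,
      (CategoryTheory.Injective.ι (ModuleCat.of R X)).hom, (ModuleCat.mono_iff_injective _).1 inferInstance⟩
  let S : Set (Submodule R I) := {U | LinearMap.range g ≤ U ∧
    ∀ x ∈ U, x ≠ 0 → ∃ r : R, r • x ∈ LinearMap.range g ∧ r • x ≠ 0}
  obtain ⟨U, -, hU⟩ := zorn_le_nonempty₀ S (fun c hc hch y hy => by
    refine ⟨sSup c, ⟨(hc hy).1.trans (le_sSup hy), fun x hx hx0 => ?_⟩, fun z hz => le_sSup hz⟩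
    obtain ⟨z, hz, hxz⟩ := (Submodule.mem_sSup_of_directed ⟨y, hy⟩ hch.directedOn).1 hx
    exact (hc hz).2 x hxz hx0) (LinearMap.range g)
    ⟨le_rfl, fun x hx hx0 => ⟨1, by simpa using hx, by simpa using hx0⟩⟩
  have hUS : U ∈ S := hU.1
  obtain ⟨W, -, hW⟩ := zorn_le_nonempty₀ {W : Submodule R I | ∀ x ∈ W, x ∈ U → x = 0}
    (fun c hc hch y hy => by
      refine ⟨sSup c, fun x hx hxU => ?_, fun z hz => le_sSup hz⟩
      obtain ⟨z, hz, hxz⟩ := (Submodule.mem_sSup_of_directed ⟨y, hy⟩ hch.directedOn).1 hx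
      exact hc hz x hxz hxU) ⊥ (fun x hx _ => by simpa using hx)
  have hW1 : ∀ x ∈ W, x ∈ U → x = 0 := hW.1
  obtain ⟨h, hh⟩ := hI.out (W.mkQ ∘ₗ U.subtype) (by
    rw [← LinearMap.ker_eq_bot, LinearMap.ker_eq_bot']
    rintro ⟨x, hx⟩ hx0
    have : x ∈ W := by simpa using hx0
    simpa using hW1 x this hx) U.subtype
  have hh' : ∀ x ∈ U, h (W.mkQ x) = x := fun x hx => hh ⟨x, hx⟩
  have hrange : LinearMap.range (h ∘ₗ W.mkQ) ∈ S := by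
    have hle : U ≤ LinearMap.range (h ∘ₗ W.mkQ) := fun x hx => ⟨x, hh' x hx⟩
    refine ⟨hUS.1.trans hle, ?_⟩
    rintro _ ⟨x, rfl⟩ hx0
    have hxW : x ∉ W := fun hx => hx0 (by
      have : W.mkQ x = 0 := by simpa using hx
      simp only [LinearMap.comp_apply, this, map_zero])
    have hnot : ¬ ∀ z ∈ W ⊔ Submodule.span R {x}, z ∈ U → z = 0 := fun hz => hxW
      (hW.le_of_ge hz le_sup_left
        (Submodule.mem_sup_right (Submodule.mem_span_singleton_self x)))
    push Not at hnot
    obtain ⟨z, hz, hzU, hz0⟩ := hnot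
    obtain ⟨w, hw, y, hy, rfl⟩ := Submodule.mem_sup.1 hz
    obtain ⟨r, rfl⟩ := Submodule.mem_span_singleton.1 hy
    obtain ⟨s, hs, hs0⟩ := hUS.2 _ hzU hz0
    have key : w + r • x = r • (h ∘ₗ W.mkQ) x := by
      have hw0 : W.mkQ w = 0 := by simpa using hw
      rw [← hh' _ hzU, map_add, hw0, zero_add, map_smul, map_smul]
      rfl
    rw [key, smul_smul] at hs hs0
    exact ⟨s * r, hs, hs0⟩
  have hmem : ∀ x, (h ∘ₗ W.mkQ) x ∈ U := fun x =>
    hU.le_of_ge hrange (fun x hx => ⟨x, hh' x hx⟩) ⟨x, rfl⟩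
  refine ⟨ModuleCat.of R U, g.codRestrict U fun x => hUS.1 ⟨x, rfl⟩, ⟨⟨?_⟩, ?_, ?_⟩⟩
  · intro Y Z _ _ _ _ f hf p
    obtain ⟨q, hq⟩ := hI.out f hf (U.subtype ∘ₗ p)
    refine ⟨(h ∘ₗ W.mkQ).codRestrict U hmem ∘ₗ q, fun x => Subtype.ext ?_⟩
    have : q (f x) = (p x : I) := hq x
    change h (W.mkQ (q (f x))) = (p x : I)
    rw [this, hh' _ (p x).2]
  · intro x y hxy
    exact hg (congrArg Subtype.val hxy)
  · intro V hV
    rw [eq_bot_iff]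
    intro x hx
    by_contra hx0
    have hx0' : (x : I) ≠ 0 := fun hx1 => hx0 (by simpa using Subtype.ext hx1)
    obtain ⟨r, ⟨y, hy⟩, hr0⟩ := hUS.2 x x.2 hx0'
    have : r • x ∈ V ⊓ LinearMap.range (g.codRestrict U fun x => hUS.1 ⟨x, rfl⟩) :=
      ⟨V.smul_mem r hx, y, Subtype.ext hy⟩
    rw [hV] at this
    exact hr0 (congrArg Subtype.val ((Submodule.mem_bot R).1 this))

/-- An injective envelope of the `k`-module `k / rad k`. -/
noncomputable def DualizingModule (k : Type u) [CommRing k] : ModuleCat.{u} k :=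
  (exists_isInjectiveEnvelope k (k ⧸ Ring.jacobson k)).choose

theorem DualizingModule.exists_envelope (k : Type u) [CommRing k] :
    ∃ f : (k ⧸ Ring.jacobson k) →ₗ[k] DualizingModule k, IsInjectiveEnvelope f :=
  (exists_isInjectiveEnvelope k (k ⧸ Ring.jacobson k)).choose_spec

end InjectiveEnvelope

section Dual

variable (k A : Type u) [CommRing k] [Ring A] [Algebra k A]

/-- The bimodule `DA`, where `D = Hom_k(-, E)` is the standard duality, `E` being the injective
envelope of `k / rad k`. -/
def DualBimodule : Type u := A →ₗ[k] DualizingModule k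

namespace DualBimodule

noncomputable instance : AddCommGroup (DualBimodule k A) :=
  inferInstanceAs (AddCommGroup (A →ₗ[k] DualizingModule k))

variable {k A}

/-- Evaluation of `φ : DA` at an element of `A`. -/
noncomputable def eval (φ : DualBimodule k A) (x : A) : DualizingModule k :=
  (show A →ₗ[k] DualizingModule k from φ) x

@[ext] theorem ext {φ ψ : DualBimodule k A} (h : ∀ x, φ.eval x = ψ.eval x) : φ = ψ :=
  LinearMap.ext h

@[simp] theorem eval_zero (x : A) : eval (0 : DualBimodule k A) x = 0 := rfl

@[simp] theorem eval_add (φ ψ : DualBimodule k A) (x : A) :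
    (φ + ψ).eval x = φ.eval x + ψ.eval x := rfl

@[simp] theorem eval_zero_right (φ : DualBimodule k A) : φ.eval 0 = 0 :=
  map_zero (show A →ₗ[k] DualizingModule k from φ)

@[simp] theorem eval_add_right (φ : DualBimodule k A) (x y : A) :
    φ.eval (x + y) = φ.eval x + φ.eval y :=
  map_add (show A →ₗ[k] DualizingModule k from φ) x y

/-- The left action `(a φ)(x) = φ (x a)`. -/
noncomputable instance : SMul A (DualBimodule k A) where
  smul a φ := (show A →ₗ[k] DualizingModule k from φ) ∘ₗ LinearMap.mulRight k a

/-- The right action `(φ a)(x) = φ (a x)`. -/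
noncomputable instance : SMul Aᵐᵒᵖ (DualBimodule k A) where
  smul a φ := (show A →ₗ[k] DualizingModule k from φ) ∘ₗ LinearMap.mulLeft k a.unop

@[simp] theorem eval_smul (a : A) (φ : DualBimodule k A) (x : A) :
    (a • φ).eval x = φ.eval (x * a) := rfl

@[simp] theorem eval_op_smul (a : Aᵐᵒᵖ) (φ : DualBimodule k A) (x : A) :
    (a • φ).eval x = φ.eval (a.unop * x) := rfl

noncomputable instance : Module A (DualBimodule k A) where
  one_smul φ := by ext x; simp
  mul_smul a b φ := by ext x; simp [mul_assoc]
  smul_zero a := by ext x; simp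
  smul_add a φ ψ := by ext x; simp
  add_smul a b φ := by ext x; simp [mul_add]
  zero_smul φ := by ext x; simp

noncomputable instance : Module Aᵐᵒᵖ (DualBimodule k A) where
  one_smul φ := by ext x; simp
  mul_smul a b φ := by ext x; simp [mul_assoc]
  smul_zero a := by ext x; simp
  smul_add a φ ψ := by ext x; simp
  add_smul a b φ := by ext x; simp [add_mul]
  zero_smul φ := by ext x; simp

instance : SMulCommClass A Aᵐᵒᵖ (DualBimodule k A) where
  smul_comm a b φ := by ext x; simp [mul_assoc]

end DualBimodule

end Dual

section Replicated

variable (k A : Type u) [CommRing k] [Ring A] [Algebra k A] (m : ℕ)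

/-- The `m`-replicated algebra of `A`. Its elements are the lower triangular `(m+1) × (m+1)`
matrices, rows and columns numbered from `0` to `m`, with entries `diag i` in `A` at the positions
`(i, i)`, entries `sub i` in `DA` at the positions `(i + 1, i)`, and zeros elsewhere. -/
@[ext] structure ReplicatedAlgebra where
  diag : Fin (m + 1) → A
  sub : Fin m → DualBimodule k A

namespace ReplicatedAlgebra

variable {k A m}

noncomputable instance : Zero (ReplicatedAlgebra k A m) := ⟨⟨0, 0⟩⟩

noncomputable instance : One (ReplicatedAlgebra k A m) := ⟨⟨1, 0⟩⟩

noncomputable instance : Add (ReplicatedAlgebra k A m) :=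
  ⟨fun a b => ⟨a.diag + b.diag, a.sub + b.sub⟩⟩

noncomputable instance : Neg (ReplicatedAlgebra k A m) := ⟨fun a => ⟨-a.diag, -a.sub⟩⟩

/-- Matrix multiplication, with the bimodule structure of `DA` and the zero map
`DA ⊗ DA → 0`: the entry of `a * b` at `(i + 1, i)` is
`a_{i+1,i+1} b_{i+1,i} + a_{i+1,i} b_{i,i}`. -/
noncomputable instance : Mul (ReplicatedAlgebra k A m) :=
  ⟨fun a b => ⟨fun i => a.diag i * b.diag i, fun i =>
    a.diag i.succ • b.sub i + MulOpposite.op (b.diag i.castSucc) • a.sub i⟩⟩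

@[simp] theorem diag_zero : (0 : ReplicatedAlgebra k A m).diag = 0 := rfl
@[simp] theorem sub_zero : (0 : ReplicatedAlgebra k A m).sub = 0 := rfl
@[simp] theorem diag_one : (1 : ReplicatedAlgebra k A m).diag = 1 := rfl
@[simp] theorem sub_one : (1 : ReplicatedAlgebra k A m).sub = 0 := rfl
@[simp] theorem diag_add (a b : ReplicatedAlgebra k A m) : (a + b).diag = a.diag + b.diag := rfl
@[simp] theorem sub_add (a b : ReplicatedAlgebra k A m) : (a + b).sub = a.sub + b.sub := rfl
@[simp] theorem diag_neg (a : ReplicatedAlgebra k A m) : (-a).diag = -a.diag := rfl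
@[simp] theorem sub_neg (a : ReplicatedAlgebra k A m) : (-a).sub = -a.sub := rfl
@[simp] theorem diag_mul (a b : ReplicatedAlgebra k A m) (i : Fin (m + 1)) :
    (a * b).diag i = a.diag i * b.diag i := rfl
@[simp] theorem sub_mul (a b : ReplicatedAlgebra k A m) (i : Fin m) :
    (a * b).sub i =
      a.diag i.succ • b.sub i + MulOpposite.op (b.diag i.castSucc) • a.sub i := rfl

noncomputable instance : Ring (ReplicatedAlgebra k A m) where
  add_assoc a b c := by ext <;> simp [add_assoc]
  zero_add a := by ext <;> simp
  add_zero a := by ext <;> simp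
  add_comm a b := by ext <;> simp [add_comm]
  neg_add_cancel a := by ext <;> simp
  nsmul := nsmulRec
  zsmul := zsmulRec
  one_mul a := by ext <;> simp
  mul_one a := by ext <;> simp
  zero_mul a := by ext <;> simp
  mul_zero a := by ext <;> simp
  left_distrib a b c := by ext <;> simp [mul_add, add_mul, add_assoc, add_left_comm]
  right_distrib a b c := by ext <;> simp [mul_add, add_mul, add_assoc, add_left_comm]
  mul_assoc a b c := by ext <;> simp [mul_assoc, add_assoc]

/-- The projection of the `m`-replicated algebra onto its `i`-th diagonal copy `A_i = A`. -/
noncomputable def proj (i : Fin (m + 1)) : ReplicatedAlgebra k A m →+* A where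
  toFun a := a.diag i
  map_zero' := rfl
  map_one' := rfl
  map_add' _ _ := rfl
  map_mul' _ _ := rfl

end ReplicatedAlgebra

/-- The standard embedding `mod A_i → mod A^{(m)}`: the right `A`-module `X`, regarded as a right
module over the `m`-replicated algebra through the projection onto the `i`-th copy of `A`. -/
def AtCopy (_k _A : Type u) (m : ℕ) (_i : Fin (m + 1)) (X : Type u) : Type u := X

instance (i : Fin (m + 1)) (X : Type u) [AddCommGroup X] : AddCommGroup (AtCopy k A m i X) :=
  inferInstanceAs (AddCommGroup X)

noncomputable instance (i : Fin (m + 1)) (X : Type u) [AddCommGroup X] [Module Aᵐᵒᵖ X] :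
    Module (ReplicatedAlgebra k A m)ᵐᵒᵖ (AtCopy k A m i X) :=
  Module.compHom X (RingHom.op (ReplicatedAlgebra.proj (k := k) (A := A) (m := m) i))

/-- The right `A^{(m)}`-module `A ⊕ DA_m ⊕ P ⊕ N'`, where `A = A_0`, `N'` is a right `A`-module
regarded as an `A_0`-module, and `P` is the direct sum of all indecomposable
projective-injective `A^{(m)}`-modules. -/
abbrev ExtensionModule (N' : Type u) : Type u :=
  AtCopy k A m 0 A × AtCopy k A m (Fin.last m) (DualBimodule k A) ×
    SumProjInj (ReplicatedAlgebra k A m) × AtCopy k A m 0 N'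

end Replicated

/-! ### Matlis duality over the artinian base ring. -/

section MatlisDuality

variable {k : Type u} [CommRing k] {E : Type u} [AddCommGroup E] [Module k E]
  {f : (k ⧸ Ring.jacobson k) →ₗ[k] E}

/-! Write `R` for the replicated algebra. The right module `R` is the direct sum of `A_0` and the
rows numbered `1, ..., m`, each consisting of an entry in `DA` and an entry in `A`. By Matlis
duality (`DDA ≅ A`), row `i + 1` is the `k`-dual of the left ideal given by column `i`, hence
injective; the dual of the last column is `DA_m`. So an indecomposable projective is a summand of
`A_0` or projective-injective, and an indecomposable injective is a summand of `DA_m` or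
projective-injective. The sum `P` is finitely generated because its terms are pairwise
non-isomorphic indecomposable summands of `R`, of which there are finitely many.

The infinite dimension is that of `F N`, where `F = Hom(M, -)`. Since `End N` is a division ring and
the sequence does not split, every map `N' → N` kills `u N`, and every endomorphism `t` of `N'` is
either invertible or satisfies `v t = 0` (`isUnit_or_comp_eq_zero`). Moreover `Hom(DA, N) = 0`: over
a hereditary ring the image of an injective module is injective, so a nonzero image would make `N`
injective and split the sequence.

Choose a minimal generating family `f_1, ..., f_r` of `Hom(N', N)` over `End N'`, and let `K` be the
kernel of the induced map `Φ : N'^r → N`. Then `0 → F K → F (N'^r) → F N → 0` is exact with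
projective middle term. Also `u` embeds `N^r` in `K`, with quotient `X = v^r(K) ⊆ N^r`. By
minimality no map `N' → K` has an invertible component, so maps `M → K` followed by `K → X` vanish
on `N'`. Hence the image `L` of `F K → F X` is also the image of `F (A^l) → F X` for a projective
cover-like surjection `A^l → X`, whose kernel is projective because `A` is hereditary; thus `pd L ≤
1`. From `0 → F (N^r) → F K → L → 0`, the bound `pd (F N) ≤ d + 1` improves to `pd (F N) ≤ d`. A
finite dimension would descend to `0`, but `F N` is not projective (`not_projective_homFrom`). -/

theorem mem_jacobson_of_mul_mem (I : Ideal k) {y : k} (hy : y ∈ I)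
    (h : ∀ x ∈ I, x * y ∈ Ring.jacobson k) : y ∈ Ring.jacobson k := by
  -- The case `x = y` suffices because the Jacobson radical is a radical ideal.
  have h2 : y ^ 2 ∈ Ring.jacobson k := by simpa [sq] using h y hy
  rw [← Ideal.jacobson_bot] at h2 ⊢
  exact (Ideal.isRadical_jacobson (⊥ : Ideal k)) ⟨2, h2⟩

/-- By essentiality a nonzero `φ s` has a nonzero multiple in the image of `k / rad k`; that
multiple comes from a generator of the simple module, so `φ s` is a multiple of it. -/
theorem IsInjectiveEnvelope.apply_mem_range (hf : IsInjectiveEnvelope f) {X : Type u}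
    [AddCommGroup X] [Module k X] [IsSimpleModule k X] (φ : X →ₗ[k] E) (s : X) :
    φ s ∈ LinearMap.range f := by
  by_contra hs
  have h0 : φ s ≠ 0 := fun h => hs (h ▸ zero_mem _)
  have := mt (hf.essential (Submodule.span k {φ s})) (by simpa using h0)
  obtain ⟨y, ⟨hy, hyf⟩, hy0⟩ := (Submodule.ne_bot_iff _).1 this
  obtain ⟨c, rfl⟩ := Submodule.mem_span_singleton.1 hy
  have hcs : c • s ≠ 0 := fun h => hy0 (by rw [← map_smul, h, map_zero])
  obtain ⟨d, hd⟩ := IsSimpleModule.toSpanSingleton_surjective k hcs s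
  apply hs
  rw [← hd, LinearMap.toSpanSingleton_apply, map_smul, map_smul]
  exact Submodule.smul_mem _ _ hyf

theorem IsInjectiveEnvelope.length_hom_le_of_isSimpleModule (hf : IsInjectiveEnvelope f)
    (X : Type u) [AddCommGroup X] [Module k X] [IsSimpleModule k X] :
    Module.length k (X →ₗ[k] E) ≤ 1 := by
  rcases subsingleton_or_nontrivial (X →ₗ[k] E) with hs | hn
  · simp
  suffices IsSimpleModule k (X →ₗ[k] E) from Module.length_eq_one k _ |>.le
  refine isSimpleModule_iff_toSpanSingleton_surjective.2 ⟨hn, fun φ hφ ψ => ?_⟩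
  have := IsSimpleModule.nontrivial k X
  obtain ⟨s, hs⟩ := exists_ne (0 : X)
  have hsurj := IsSimpleModule.toSpanSingleton_surjective k hs
  let I : Ideal k := LinearMap.ker (LinearMap.toSpanSingleton k X s)
  have hI : ∀ x, x ∈ I ↔ x • s = 0 := fun x => by simp [I]
  -- A map out of `X` is determined by its value at `s`, a class `y` in `k / rad k` annihilated by
  -- the annihilator `I` of `s`.
  have key : ∀ χ : X →ₗ[k] E, ∃ y : k, f (Submodule.Quotient.mk y) = χ s ∧
      ∀ x ∈ I, x * y ∈ Ring.jacobson k := fun χ => by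
    obtain ⟨y, hy⟩ := hf.apply_mem_range χ s
    obtain ⟨y, rfl⟩ := Submodule.Quotient.mk_surjective _ y
    refine ⟨y, hy, fun x hx => ?_⟩
    rw [← smul_eq_mul, ← Submodule.Quotient.mk_eq_zero, Submodule.Quotient.mk_smul]
    apply hf.injective_map
    rw [map_smul, hy, ← map_smul, (hI x).1 hx, map_zero, map_zero]
  obtain ⟨y, hy, hyI⟩ := key φ
  obtain ⟨z, hz, hzI⟩ := key ψ
  -- If `y` were in `I`, then `y ^ 2`, hence `y`, would lie in the radical and `φ` would vanish.
  have hyn : y • s ≠ 0 := fun h => by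
    have h1 := mem_jacobson_of_mul_mem I ((hI y).2 h) hyI
    rw [(Submodule.Quotient.mk_eq_zero _).2 h1, map_zero] at hy
    refine hφ (LinearMap.ext fun x => ?_)
    obtain ⟨c, rfl⟩ := hsurj x
    simp [← hy]
  obtain ⟨c, hc⟩ := IsSimpleModule.toSpanSingleton_surjective k hyn (z • s)
  have hcz : c * y - z ∈ Ring.jacobson k := by
    refine mem_jacobson_of_mul_mem I ((hI _).2 ?_) fun x hx => ?_
    · rw [LinearMap.toSpanSingleton_apply] at hc
      rw [sub_smul, mul_smul, hc, sub_self]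
    · have : x * (c * y - z) = c * (x * y) - x * z := by ring
      rw [this]
      exact sub_mem (Ideal.mul_mem_left _ _ (hyI x hx)) (hzI x hx)
  refine ⟨c, LinearMap.ext fun x => ?_⟩
  obtain ⟨d, rfl⟩ := hsurj x
  have h3 : c • φ s = ψ s := by
    rw [← hy, ← hz, ← map_smul, ← Submodule.Quotient.mk_smul, ← sub_eq_zero, ← map_sub,
      ← Submodule.Quotient.mk_sub, smul_eq_mul, (Submodule.Quotient.mk_eq_zero _).2 hcz, map_zero]
  simp [h3]

theorem IsInjectiveEnvelope.length_hom_le (hf : IsInjectiveEnvelope f)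
    (X : Type u) [AddCommGroup X] [Module k X] (hX : IsFiniteLength k X) :
    Module.length k (X →ₗ[k] E) ≤ Module.length k X := by
  induction hX with
  | of_subsingleton => simp
  | @of_simple_quotient X _ _ U _ hU ih =>
    have hinj : Function.Injective (LinearMap.lcomp k E U.mkQ) := fun φ ψ h =>
      LinearMap.ext fun x => by
        obtain ⟨x, rfl⟩ := U.mkQ_surjective x
        exact LinearMap.congr_fun h x
    have hsurj : Function.Surjective (LinearMap.lcomp k E U.subtype) := fun φ => by
      obtain ⟨ψ, hψ⟩ := hf.injective.out U.subtype U.subtype_injective φ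
      exact ⟨ψ, LinearMap.ext hψ⟩
    have hex : Function.Exact (LinearMap.lcomp k E U.mkQ) (LinearMap.lcomp k E U.subtype) := by
      intro φ
      constructor
      · intro h
        refine ⟨U.liftQ φ fun x hx => LinearMap.congr_fun h ⟨x, hx⟩, LinearMap.ext fun x => rfl⟩
      · rintro ⟨ψ, rfl⟩
        ext x
        have h0 : U.mkQ (x : X) = 0 := (Submodule.Quotient.mk_eq_zero _).2 x.2
        change ψ (U.mkQ x) = 0
        rw [h0, map_zero]
    rw [Module.length_eq_add_of_exact _ _ hinj hsurj hex,
      Module.length_eq_add_of_exact U.subtype U.mkQ U.subtype_injective U.mkQ_surjective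
        (LinearMap.exact_subtype_mkQ U), add_comm]
    refine add_le_add ih ?_
    rw [Module.length_eq_one k (X ⧸ U)]
    exact hf.length_hom_le_of_isSimpleModule _

variable [IsArtinianRing k]

theorem isFiniteLength_of_finite (X : Type u) [AddCommGroup X] [Module k X] [Module.Finite k X] :
    IsFiniteLength k X :=
  isFiniteLength_iff_isNoetherian_isArtinian.2 ⟨inferInstance, inferInstance⟩

/-- A simple module is a quotient of the semisimple module `k / rad k`, hence also a submodule of
it, and `f` embeds it in `E`. -/
theorem IsInjectiveEnvelope.exists_ne_zero_of_isSimpleModule (hf : IsInjectiveEnvelope f)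
    (X : Type u) [AddCommGroup X] [Module k X] [IsSimpleModule k X] :
    ∃ φ : X →ₗ[k] E, φ ≠ 0 := by
  have := IsSimpleModule.nontrivial k X
  obtain ⟨I, hI, ⟨e⟩⟩ := isSimpleModule_iff_quot_maximal.1 ‹IsSimpleModule k X›
  have hJI : Ring.jacobson k ≤ I := by
    rw [← Ideal.jacobson_bot]
    exact sInf_le ⟨bot_le, hI⟩
  have : IsSemisimpleModule k (k ⧸ Ring.jacobson k) :=
    (IsArtinian.isSemisimpleModule_iff_jacobson k _).2
      (Module.jacobson_quotient_jacobson k k)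
  obtain ⟨V, ⟨e'⟩⟩ := IsSemisimpleModule.exists_submodule_linearEquiv_quotient
    (Submodule.map (Submodule.mkQ (Ring.jacobson k)) I)
  let g : X ≃ₗ[k] V := e.trans
    ((Submodule.quotientQuotientEquivQuotient (Ring.jacobson k) I hJI).symm.trans e'.symm)
  obtain ⟨s, hs⟩ := exists_ne (0 : X)
  refine ⟨f ∘ₗ V.subtype ∘ₗ g.toLinearMap, fun h => hs ?_⟩
  have h1 : f (g s : k ⧸ Ring.jacobson k) = f 0 := by
    rw [map_zero]
    exact LinearMap.congr_fun h s
  have h2 : g s = 0 := Subtype.ext (hf.injective_map h1)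
  simpa using h2

theorem IsInjectiveEnvelope.exists_apply_ne_zero (hf : IsInjectiveEnvelope f)
    {X : Type u} [AddCommGroup X] [Module k X] {x : X} (hx : x ≠ 0) :
    ∃ φ : X →ₗ[k] E, φ x ≠ 0 := by
  let U := Submodule.span k {x}
  let s : U := ⟨x, Submodule.mem_span_singleton_self x⟩
  have hs : s ≠ 0 := fun h => hx (congrArg Subtype.val h)
  have : Nontrivial U := ⟨s, 0, hs⟩
  obtain ⟨V, hV⟩ := IsCoatomic.exists_coatom (Submodule k U)
  have : IsSimpleModule k (U ⧸ V) := isSimpleModule_iff_isCoatom.2 hV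
  obtain ⟨φ, hφ⟩ := hf.exists_ne_zero_of_isSimpleModule (U ⧸ V)
  obtain ⟨ψ, hψ⟩ := hf.injective.out U.subtype U.subtype_injective (φ ∘ₗ V.mkQ)
  refine ⟨ψ, fun h0 => hφ (LinearMap.ext fun y => ?_)⟩
  obtain ⟨⟨y, hy⟩, rfl⟩ := V.mkQ_surjective y
  obtain ⟨c, rfl⟩ := Submodule.mem_span_singleton.1 hy
  have h1 := hψ ⟨c • x, hy⟩
  rw [LinearMap.comp_apply] at h1
  rw [← h1, Submodule.subtype_apply, map_smul, h0, smul_zero, LinearMap.zero_apply]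

theorem IsInjectiveEnvelope.finite_hom (hf : IsInjectiveEnvelope f)
    (X : Type u) [AddCommGroup X] [Module k X] [Module.Finite k X] :
    Module.Finite k (X →ₗ[k] E) := by
  have h := hf.length_hom_le X (isFiniteLength_of_finite X)
  have : IsFiniteLength k (X →ₗ[k] E) := Module.length_ne_top_iff.1
    (ne_top_of_le_ne_top (Module.length_ne_top_iff.2 (isFiniteLength_of_finite X)) h)
  have := (isFiniteLength_iff_isNoetherian_isArtinian.1 this).1
  infer_instance

theorem IsInjectiveEnvelope.exists_eq_apply (hf : IsInjectiveEnvelope f)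
    {X : Type u} [AddCommGroup X] [Module k X] [Module.Finite k X]
    (Λ : (X →ₗ[k] E) →ₗ[k] E) : ∃ x : X, ∀ φ, Λ φ = φ x := by
  have := hf.finite_hom X
  have := hf.finite_hom (X →ₗ[k] E)
  let ev : X →ₗ[k] ((X →ₗ[k] E) →ₗ[k] E) := LinearMap.flip LinearMap.id
  have hinj : Function.Injective ev := by
    rw [← LinearMap.ker_eq_bot, LinearMap.ker_eq_bot']
    intro x hx
    by_contra h0
    obtain ⟨φ, hφ⟩ := hf.exists_apply_ne_zero h0
    exact hφ (LinearMap.congr_fun hx φ)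
  -- Dualizing does not increase length, so the injective evaluation map into the bidual is onto.
  have hle : Module.length k ((X →ₗ[k] E) →ₗ[k] E) ≤ Module.length k (LinearMap.range ev) := by
    rw [← (LinearEquiv.ofInjective ev hinj).length_eq]
    exact (hf.length_hom_le _ (isFiniteLength_of_finite _)).trans
      (hf.length_hom_le _ (isFiniteLength_of_finite _))
  have htop : LinearMap.range ev = ⊤ := by
    by_contra h
    exact (Submodule.length_lt h).not_ge hle
  obtain ⟨x, hx⟩ := LinearMap.range_eq_top.1 htop Λ
  exact ⟨x, fun φ => by rw [← hx]; rfl⟩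

theorem IsInjectiveEnvelope.exists_separating (hf : IsInjectiveEnvelope f)
    (X : Type u) [AddCommGroup X] [Module k X] [Module.Finite k X] :
    ∃ (n : ℕ) (φ : Fin n → (X →ₗ[k] E)), ∀ x, (∀ i, φ i x = 0) → x = 0 := by
  have := hf.finite_hom X
  obtain ⟨n, φ, hφ⟩ := Module.Finite.exists_fin (R := k) (M := X →ₗ[k] E)
  refine ⟨n, φ, fun x hx => ?_⟩
  by_contra h0
  obtain ⟨ψ, hψ⟩ := hf.exists_apply_ne_zero h0
  have hle : Submodule.span k (Set.range φ) ≤ LinearMap.ker (LinearMap.flip LinearMap.id x) :=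
    Submodule.span_le.2 (by rintro _ ⟨i, rfl⟩; exact hx i)
  rw [hφ] at hle
  exact hψ (hle (Submodule.mem_top (x := ψ)))

end MatlisDuality

/-! ### Direct summands and local endomorphism rings. -/

section Retracts

/-- `X` is a direct summand of `Y`. -/
def IsModuleRetract (S : Type u) [Ring S] (X Y : Type u) [AddCommGroup X] [Module S X]
    [AddCommGroup Y] [Module S Y] : Prop :=
  ∃ (i : X →ₗ[S] Y) (r : Y →ₗ[S] X), r ∘ₗ i = LinearMap.id

variable {S : Type u} [Ring S] {X Y Z : Type u} [AddCommGroup X] [Module S X]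
  [AddCommGroup Y] [Module S Y] [AddCommGroup Z] [Module S Z]

theorem LinearEquiv.isModuleRetract (e : X ≃ₗ[S] Y) : IsModuleRetract S X Y :=
  ⟨e.toLinearMap, e.symm.toLinearMap, LinearMap.ext fun x => by simp⟩

theorem IsModuleRetract.trans (h : IsModuleRetract S X Y) (h' : IsModuleRetract S Y Z) :
    IsModuleRetract S X Z := by
  obtain ⟨i, r, h⟩ := h
  obtain ⟨i', r', h'⟩ := h'
  refine ⟨i' ∘ₗ i, r ∘ₗ r', LinearMap.ext fun x => ?_⟩
  have h1 : r' (i' (i x)) = i x := LinearMap.congr_fun h' _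
  have h2 : r (i x) = x := LinearMap.congr_fun h _
  simp [h1, h2]

theorem IsModuleRetract.inAdd (h : IsModuleRetract S X Y) : InAdd S Y X := by
  obtain ⟨i, r, h⟩ := h
  exact ⟨1, LinearMap.pi fun _ => i, r ∘ₗ LinearMap.proj 0, LinearMap.ext fun x =>
    LinearMap.congr_fun h x⟩

theorem IsModuleRetract.projective (h : IsModuleRetract S X Y) [Module.Projective S Y] :
    Module.Projective S X := by
  obtain ⟨i, r, h⟩ := h
  exact Module.Projective.of_split i r h

theorem IsModuleRetract.injective (h : IsModuleRetract S X Y) (hY : Module.Injective S Y) :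
    Module.Injective S X := by
  obtain ⟨i, r, h⟩ := h
  refine ⟨fun U V _ _ _ _ f hf g => ?_⟩
  obtain ⟨p, hp⟩ := hY.out f hf (i ∘ₗ g)
  refine ⟨r ∘ₗ p, fun x => ?_⟩
  have : r (i (g x)) = g x := LinearMap.congr_fun h _
  simp [hp, this]

theorem InAdd.of_isModuleRetract (h : InAdd S Y X) (hYZ : IsModuleRetract S Y Z) :
    InAdd S Z X := by
  obtain ⟨n, i, r, h⟩ := h
  obtain ⟨a, b, hab⟩ := hYZ
  refine ⟨n, LinearMap.pi fun j => a ∘ₗ LinearMap.proj j ∘ₗ i,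
    r ∘ₗ LinearMap.pi fun j => b ∘ₗ LinearMap.proj j, LinearMap.ext fun x => ?_⟩
  have h1 : ∀ y, b (a y) = y := LinearMap.congr_fun hab
  have h2 : r (i x) = x := LinearMap.congr_fun h x
  simp [h1, h2, LinearMap.pi]

theorem isModuleRetract_of_isUnit {i : X →ₗ[S] Y} {r : Y →ₗ[S] X}
    (h : IsUnit (r ∘ₗ i : Module.End S X)) : IsModuleRetract S X Y := by
  obtain ⟨w, hw⟩ := h
  refine ⟨i, (↑w⁻¹ : Module.End S X) ∘ₗ r, ?_⟩
  have := w.inv_mul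
  rw [hw] at this
  exact this

theorem isUnit_or_isUnit_of_isUnit_add {T : Type*} [Ring T] [IsLocalRing T] {a b : T}
    (h : IsUnit (a + b)) : IsUnit a ∨ IsUnit b := by
  obtain ⟨w, hw⟩ := h
  have : (↑w⁻¹ : T) * a + ↑w⁻¹ * b = 1 := by rw [← mul_add, ← hw, w.inv_mul]
  simpa [Units.isUnit_units_mul] using IsLocalRing.isUnit_or_isUnit_of_add_one this

theorem exists_isUnit_of_isUnit_sum {T ι : Type*} [Ring T] [IsLocalRing T] (s : Finset ι)
    (a : ι → T) (h : IsUnit (∑ j ∈ s, a j)) : ∃ j ∈ s, IsUnit (a j) := by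
  classical
  induction s using Finset.induction_on with
  | empty => simp at h
  | insert j s hj ih =>
    rw [Finset.sum_insert hj] at h
    rcases isUnit_or_isUnit_of_isUnit_add h with h | h
    · exact ⟨j, Finset.mem_insert_self _ _, h⟩
    · obtain ⟨l, hl, h⟩ := ih h
      exact ⟨l, Finset.mem_insert_of_mem hl, h⟩

/-- Fitting's lemma: every endomorphism is invertible or nilpotent. -/
theorem isLocalRing_end [IsNoetherian S X] [IsArtinian S X] (h : IsIndecomposableModule S X) :
    IsLocalRing (Module.End S X) := by
  have := h.1
  refine IsLocalRing.of_isUnit_or_isUnit_one_sub_self fun f => ?_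
  obtain ⟨n, hn⟩ := Filter.eventually_atTop.1 f.eventually_isCompl_ker_pow_range_pow
  -- A positive exponent is needed to pass from invertibility of the power to that of `f`.
  have hc := hn (n + 1) (Nat.le_succ n)
  rcases h.2 _ _ hc with h0 | h0
  · left
    have htop : LinearMap.range (f ^ (n + 1)) = ⊤ := by simpa [h0] using hc.sup_eq_top
    have hu : IsUnit (f ^ (n + 1)) := (Module.End.isUnit_iff _).2
      ⟨LinearMap.ker_eq_bot.1 h0, LinearMap.range_eq_top.1 htop⟩
    exact (isUnit_pow_iff (Nat.succ_ne_zero n)).1 hu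
  · right
    exact IsNilpotent.isUnit_one_sub ⟨n + 1, LinearMap.range_eq_bot.1 h0⟩

/-- The identity of `X` is the sum of its factorizations through the `Y j`; in a local ring one of
these summands is a unit. -/
theorem isModuleRetract_of_pi [IsLocalRing (Module.End S X)] {ι : Type*} [Fintype ι]
    {Y : ι → Type u} [∀ j, AddCommGroup (Y j)] [∀ j, Module S (Y j)]
    (i : X →ₗ[S] ∀ j, Y j) (r : (∀ j, Y j) →ₗ[S] X) (h : r ∘ₗ i = LinearMap.id) :
    ∃ j, IsModuleRetract S X (Y j) := by
  classical
  have hsum : ∑ j, ((r ∘ₗ LinearMap.single S Y j) ∘ₗ (LinearMap.proj j ∘ₗ i) : Module.End S X)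
      = 1 := by
    rw [Module.End.one_eq_id, ← h]
    ext x
    simp only [LinearMap.sum_apply, LinearMap.comp_apply, LinearMap.proj_apply]
    rw [← map_sum]
    congr 1
    exact LinearMap.sum_single_apply Y (i x)
  obtain ⟨j, -, hj⟩ := exists_isUnit_of_isUnit_sum Finset.univ _ (hsum ▸ isUnit_one)
  exact ⟨j, isModuleRetract_of_isUnit hj⟩

theorem InAdd.isModuleRetract [IsLocalRing (Module.End S X)] (h : InAdd S Y X) :
    IsModuleRetract S X Y := by
  obtain ⟨n, i, r, h⟩ := h
  exact (isModuleRetract_of_pi i r h).choose_spec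

theorem IsModuleRetract.of_prod [IsLocalRing (Module.End S X)]
    (h : IsModuleRetract S X (Y × Z)) : IsModuleRetract S X Y ∨ IsModuleRetract S X Z := by
  obtain ⟨i, r, h⟩ := h
  have hsum : ((r ∘ₗ LinearMap.inl S Y Z) ∘ₗ (LinearMap.fst S Y Z ∘ₗ i) : Module.End S X) +
      ((r ∘ₗ LinearMap.inr S Y Z) ∘ₗ (LinearMap.snd S Y Z ∘ₗ i) : Module.End S X) = 1 := by
    rw [Module.End.one_eq_id, ← h]
    ext x
    simp [← map_add]
  rcases isUnit_or_isUnit_of_isUnit_add (hsum ▸ isUnit_one) with h | h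
  · exact .inl (isModuleRetract_of_isUnit h)
  · exact .inr (isModuleRetract_of_isUnit h)

theorem IsModuleRetract.isCompl {i : X →ₗ[S] Y} {r : Y →ₗ[S] X} (h : r ∘ₗ i = LinearMap.id) :
    IsCompl (LinearMap.range i) (LinearMap.ker r) := by
  have hr : ∀ x, r (i x) = x := fun x => LinearMap.congr_fun h x
  refine ⟨Submodule.disjoint_def.2 ?_, codisjoint_iff.2 (eq_top_iff.2 fun y _ => ?_)⟩
  · rintro _ ⟨x, rfl⟩ hx
    rw [LinearMap.mem_ker, hr] at hx
    rw [hx, map_zero]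
  · rw [← add_sub_cancel (i (r y)) y]
    exact Submodule.add_mem_sup ⟨_, rfl⟩ (by simp [hr])

theorem IsModuleRetract.nonempty_linearEquiv [Nontrivial X] (h : IsModuleRetract S X Y)
    (hY : IsIndecomposableModule S Y) : Nonempty (X ≃ₗ[S] Y) := by
  obtain ⟨i, r, h⟩ := h
  have hc := IsModuleRetract.isCompl h
  have hi : Function.Injective i := fun x y hxy => by
    have := congrArg r hxy
    rwa [← LinearMap.comp_apply, ← LinearMap.comp_apply, h] at this
  rcases hY.2 _ _ hc with h0 | h0
  · obtain ⟨x, hx⟩ := exists_ne (0 : X)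
    exact absurd (hi (by rw [LinearMap.range_eq_bot.1 h0]; rfl)) hx
  · have : LinearMap.range i = ⊤ := by simpa [h0] using hc.sup_eq_top
    exact ⟨LinearEquiv.ofBijective i ⟨hi, LinearMap.range_eq_top.1 this⟩⟩

/-- A module of finite length has, up to isomorphism, finitely many indecomposable direct
summands. -/
theorem finite_setOf_isModuleRetract [IsArtinian S X] {ι : Type*} (Y : ι → Type u)
    [∀ c, AddCommGroup (Y c)] [∀ c, Module S (Y c)] (hnt : ∀ c, Nontrivial (Y c))
    (hloc : ∀ c, IsLocalRing (Module.End S (Y c)))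
    (hiso : ∀ c d, Nonempty (Y c ≃ₗ[S] Y d) → c = d) :
    {c | IsModuleRetract S (Y c) X}.Finite := by
  suffices h : ∀ U : Submodule S X, {c | IsModuleRetract S (Y c) U}.Finite by
    refine (h ⊤).subset fun c hc => hc.trans (Submodule.topEquiv (R := S)).symm.isModuleRetract
  intro U
  -- An indecomposable `U` contributes at most one index. If `U = V ⊕ W`, locality puts each counted
  -- summand of `U` in `V` or in `W`, both strictly smaller.
  induction U using WellFoundedLT.induction with
  | _ U ih =>
    by_cases hU : IsIndecomposableModule S U
    · refine Set.Subsingleton.finite fun c hc d hd => hiso c d ?_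
      obtain ⟨e⟩ := IsModuleRetract.nonempty_linearEquiv hc hU
      obtain ⟨e'⟩ := IsModuleRetract.nonempty_linearEquiv hd hU
      exact ⟨e.trans e'.symm⟩
    · rcases subsingleton_or_nontrivial U with hs | hn
      · convert! Set.finite_empty
        refine Set.eq_empty_of_forall_notMem fun c ⟨i, r, h⟩ => ?_
        obtain ⟨x, hx⟩ := exists_ne (0 : Y c)
        apply hx
        have := LinearMap.congr_fun h x
        rw [LinearMap.comp_apply, Subsingleton.elim (i x) 0, map_zero] at this
        exact this.symm
      · have hnot : ¬ ∀ V W : Submodule S U, IsCompl V W → V = ⊥ ∨ W = ⊥ := fun h => hU ⟨hn, h⟩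
        push Not at hnot
        obtain ⟨V, W, hVW, hV, hW⟩ := hnot
        have hlt : ∀ V : Submodule S U, V ≠ ⊤ → V.map U.subtype < U := fun V h => by
          refine lt_of_le_of_ne (Submodule.map_subtype_le U V) fun h' => h ?_
          rw [eq_top_iff]
          intro x _
          obtain ⟨y, hy, hxy⟩ : (x : X) ∈ V.map U.subtype := h'.ge x.2
          rwa [← Subtype.ext hxy]
        have hV' : V ≠ ⊤ := fun h => hW (by simpa [h] using hVW.inf_eq_bot)
        have hW' : W ≠ ⊤ := fun h => hV (by simpa [h] using hVW.inf_eq_bot)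
        refine ((ih _ (hlt V hV')).union (ih _ (hlt W hW'))).subset fun c hc => ?_
        have := hloc c
        have h2 := hc.trans (Submodule.prodEquivOfIsCompl V W hVW).symm.isModuleRetract
        rcases h2.of_prod with h | h
        · exact .inl (h.trans
            (Submodule.equivMapOfInjective _ U.subtype_injective V).isModuleRetract)
        · exact .inr (h.trans
            (Submodule.equivMapOfInjective _ U.subtype_injective W).isModuleRetract)

end Retracts

/-! ### Finitely generated projectives and the sum of the projective-injectives. -/

section SumProjInj

variable (R : Type u) [Ring R]

/-- The right regular module, as the left regular module of the opposite ring. -/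
def opSelfEquiv : R ≃ₗ[Rᵐᵒᵖ] Rᵐᵒᵖ where
  __ := MulOpposite.opAddEquiv
  map_smul' _ _ := rfl

instance finite_right_self : Module.Finite Rᵐᵒᵖ R := Module.Finite.equiv (opSelfEquiv R).symm

instance projective_right_self : Module.Projective Rᵐᵒᵖ R :=
  Module.Projective.of_equiv (opSelfEquiv R).symm

variable {R}

theorem exists_surjective_fin_right (X : Type u) [AddCommGroup X] [Module Rᵐᵒᵖ X]
    [Module.Finite Rᵐᵒᵖ X] : ∃ (n : ℕ) (g : (Fin n → R) →ₗ[Rᵐᵒᵖ] X), Function.Surjective g := by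
  obtain ⟨n, g, hg⟩ := Module.Finite.exists_fin' Rᵐᵒᵖ X
  exact ⟨n, g ∘ₗ (LinearEquiv.piCongrRight fun _ => opSelfEquiv R).toLinearMap,
    hg.comp (LinearEquiv.surjective _)⟩

theorem inAdd_self_of_projective (X : Type u) [AddCommGroup X] [Module Rᵐᵒᵖ X]
    [Module.Finite Rᵐᵒᵖ X] [Module.Projective Rᵐᵒᵖ X] : InAdd Rᵐᵒᵖ R X := by
  obtain ⟨n, g, hg⟩ := exists_surjective_fin_right (R := R) X
  obtain ⟨s, hs⟩ := Module.projective_lifting_property g LinearMap.id hg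
  exact ⟨n, s, g, hs⟩

theorem exists_fgPresentation (X : Type u) [AddCommGroup X] [Module Rᵐᵒᵖ X]
    [Module.Finite Rᵐᵒᵖ X] : ∃ x : FGPresentation R, Nonempty (X ≃ₗ[Rᵐᵒᵖ] x.Carrier) := by
  obtain ⟨n, g, hg⟩ := exists_surjective_fin_right (R := R) X
  exact ⟨⟨n, LinearMap.ker g⟩, ⟨(g.quotKerEquivOfSurjective hg).symm⟩⟩

theorem IsIndecomposableModule.of_linearEquiv {S : Type u} [Ring S] {X Y : Type u}
    [AddCommGroup X] [Module S X] [AddCommGroup Y] [Module S Y]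
    (h : IsIndecomposableModule S X) (e : X ≃ₗ[S] Y) : IsIndecomposableModule S Y := by
  have := h.1
  refine ⟨e.symm.toEquiv.nontrivial, fun U V hUV => ?_⟩
  have hc := (OrderIso.isCompl_iff (Submodule.orderIsoMapComap e.symm)).1 hUV
  exact (h.2 _ _ hc).imp (fun h => by simpa using h) (fun h => by simpa using h)

theorem isModuleRetract_sumProjInj (X : Type u) [AddCommGroup X] [Module Rᵐᵒᵖ X]
    [Module.Finite Rᵐᵒᵖ X] (hX : IsIndecomposableModule Rᵐᵒᵖ X)
    (hproj : Module.Projective Rᵐᵒᵖ X) (hinj : Module.Injective Rᵐᵒᵖ X) :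
    IsModuleRetract Rᵐᵒᵖ X (SumProjInj R) := by
  classical
  obtain ⟨x, ⟨e⟩⟩ := exists_fgPresentation (R := R) X
  let y : IndecProjInj R := ⟨x, hX.of_linearEquiv e, Module.Projective.of_equiv e,
    e.symm.isModuleRetract.injective hinj⟩
  have hy : Quotient.out ⟦y⟧ ≈ y := Quotient.mk_out y
  obtain ⟨e'⟩ := hy
  refine (e.trans e'.symm).isModuleRetract.trans ?_
  let F : Quotient (IndecProjInj.isoSetoid R) → Type u := fun c => (Quotient.out c).1.Carrier
  refine ⟨DirectSum.lof Rᵐᵒᵖ _ F ⟦y⟧, DirectSum.component Rᵐᵒᵖ _ F ⟦y⟧, LinearMap.ext fun z => ?_⟩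
  exact DirectSum.component.lof_self Rᵐᵒᵖ (M := F) ⟦y⟧ z

instance projective_sumProjInj : Module.Projective Rᵐᵒᵖ (SumProjInj R) := by
  let F : Quotient (IndecProjInj.isoSetoid R) → Type u := fun c => (Quotient.out c).1.Carrier
  have : ∀ c, Module.Projective Rᵐᵒᵖ (F c) := fun c => (Quotient.out c).2.2.1
  classical
  exact inferInstanceAs (Module.Projective Rᵐᵒᵖ (Π₀ c, F c))

theorem finite_sumProjInj [IsArtinianRing Rᵐᵒᵖ] : Module.Finite Rᵐᵒᵖ (SumProjInj R) := by
  let F : Quotient (IndecProjInj.isoSetoid R) → Type u := fun c => (Quotient.out c).1.Carrier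
  have hfin : ∀ c, Module.Finite Rᵐᵒᵖ (F c) := fun c =>
    inferInstanceAs (Module.Finite Rᵐᵒᵖ ((_ → R) ⧸ _))
  have hloc : ∀ c, IsLocalRing (Module.End Rᵐᵒᵖ (F c)) := fun c =>
    isLocalRing_end (Quotient.out c).2.1
  have : IsArtinian Rᵐᵒᵖ R := inferInstance
  have h := finite_setOf_isModuleRetract (S := Rᵐᵒᵖ) (X := R) F
    (fun c => (Quotient.out c).2.1.1) hloc (fun c d h => by
      rw [← Quotient.out_eq c, ← Quotient.out_eq d]
      exact Quotient.sound h)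
  have : Finite (Quotient (IndecProjInj.isoSetoid R)) := by
    refine Set.finite_univ_iff.1 (h.subset fun c _ => ?_)
    have : Module.Projective Rᵐᵒᵖ (F c) := (Quotient.out c).2.2.1
    have := hloc c
    exact (inAdd_self_of_projective (F c)).isModuleRetract
  exact inferInstanceAs (Module.Finite Rᵐᵒᵖ (⨁ c, F c))

end SumProjInj

/-! ### Projective dimension along short exact sequences. -/

section ProjectiveDimension

open CategoryTheory

/-- The module `X` has projective dimension smaller than `n`. -/
abbrev ProjDimLT (T : Type u) [Ring T] (X : Type u) [AddCommGroup X] [Module T X] (n : ℕ) : Prop :=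
  HasProjectiveDimensionLT (ModuleCat.of T X) n

variable {T : Type u} [Ring T] {X Y Z : Type u} [AddCommGroup X] [Module T X]
  [AddCommGroup Y] [Module T Y] [AddCommGroup Z] [Module T Z]

theorem projDimLT_one_iff : ProjDimLT T X 1 ↔ Module.Projective T X :=
  projective_iff_hasProjectiveDimensionLT_one.symm.trans
    (IsProjective.iff_projective (R := T) X).symm

theorem ProjDimLT.mono {m n : ℕ} (h : ProjDimLT T X m) (hmn : m ≤ n) : ProjDimLT T X n :=
  hasProjectiveDimensionLT_of_ge (ModuleCat.of T X) m n hmn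

theorem ProjDimLT.of_retract {n : ℕ} (hY : ProjDimLT T Y n) (h : IsModuleRetract T X Y) :
    ProjDimLT T X n := by
  obtain ⟨i, r, h⟩ := h
  let R : Retract (ModuleCat.of T X) (ModuleCat.of T Y) :=
    { i := ModuleCat.ofHom i
      r := ModuleCat.ofHom r
      retract := by rw [← ModuleCat.ofHom_comp, h]; rfl }
  exact R.hasProjectiveDimensionLT n

theorem shortExact_of_exact {f : X →ₗ[T] Y} {g : Y →ₗ[T] Z} (hf : Function.Injective f)
    (hfg : Function.Exact f g) (hg : Function.Surjective g) :
    (ModuleCat.shortComplexOfCompEqZero f g hfg.linearMap_comp_eq_zero).ShortExact :=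
  ModuleCat.shortComplex_shortExact _ hfg hf hg

theorem ProjDimLT.left {n : ℕ} (hY : ProjDimLT T Y n) (hZ : ProjDimLT T Z (n + 1))
    {f : X →ₗ[T] Y} {g : Y →ₗ[T] Z} (hf : Function.Injective f)
    (hfg : Function.Exact f g) (hg : Function.Surjective g) : ProjDimLT T X n :=
  (shortExact_of_exact hf hfg hg).hasProjectiveDimensionLT_X₁ n hY hZ

theorem ProjDimLT.right {n : ℕ} (hX : ProjDimLT T X n) (hY : ProjDimLT T Y (n + 1))
    {f : X →ₗ[T] Y} {g : Y →ₗ[T] Z} (hf : Function.Injective f)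
    (hfg : Function.Exact f g) (hg : Function.Surjective g) : ProjDimLT T Z (n + 1) :=
  (shortExact_of_exact hf hfg hg).hasProjectiveDimensionLT_X₃ n hX hY

/-- Descent: any finite bound could be lowered until the module is projective. -/
theorem projectiveDimension_eq_top (h1 : ¬ Module.Projective T X)
    (h : ∀ n, ProjDimLT T X (n + 2) → ProjDimLT T X (n + 1)) :
    projectiveDimension (ModuleCat.of T X) = ⊤ := by
  have key : ∀ n, ¬ ProjDimLT T X (n + 1) := fun n => by
    induction n with
    | zero => exact fun h' => h1 (projDimLT_one_iff.1 h')
    | succ n ih => exact fun h' => ih (h n h')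
  by_contra hne
  obtain ⟨n, hn⟩ := (projectiveDimension_ne_top_iff _).1 hne
  exact key n hn

end ProjectiveDimension

/-! ### The functor `Hom(M, -)` to modules over the endomorphism ring. -/

section HomFrom

variable (S : Type u) [Ring S] (M : Type u) [AddCommGroup M] [Module S M]

/-- `Hom(M, X)` as a right module over the endomorphism ring of `M`. -/
def HomFrom (X : Type u) [AddCommGroup X] [Module S X] : Type u := M →ₗ[S] X

variable {X Y Z : Type u} [AddCommGroup X] [Module S X] [AddCommGroup Y] [Module S Y]
  [AddCommGroup Z] [Module S Z]

namespace HomFrom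

variable {S M} in
/-- The underlying linear map. -/
def hom (φ : HomFrom S M X) : M →ₗ[S] X := φ

instance : AddCommGroup (HomFrom S M X) := inferInstanceAs (AddCommGroup (M →ₗ[S] X))

instance : Module (Module.End S M)ᵐᵒᵖ (HomFrom S M X) where
  smul γ φ := LinearMap.comp φ.hom γ.unop
  one_smul _ := rfl
  mul_smul _ _ _ := rfl
  smul_zero _ := rfl
  smul_add _ _ _ := rfl
  add_smul a b φ := LinearMap.comp_add a.unop b.unop φ.hom
  zero_smul φ := LinearMap.comp_zero φ.hom

variable {S M}

variable (M) in
/-- Composition with `f`. -/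
def map (f : X →ₗ[S] Y) : HomFrom S M X →ₗ[(Module.End S M)ᵐᵒᵖ] HomFrom S M Y where
  toFun φ := f ∘ₗ φ.hom
  map_add' _ _ := LinearMap.comp_add _ _ _
  map_smul' _ _ := rfl

theorem map_injective {f : X →ₗ[S] Y} (hf : Function.Injective f) :
    Function.Injective (map M f) := fun φ ψ h =>
  LinearMap.ext fun x => hf (LinearMap.congr_fun (show f ∘ₗ φ = f ∘ₗ ψ from h) x)

theorem exists_comp_eq {f : X →ₗ[S] Y} {g : Y →ₗ[S] Z} (hf : Function.Injective f)
    (hfg : Function.Exact f g) {φ : M →ₗ[S] Y} (h : g ∘ₗ φ = 0) :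
    ∃ ψ : M →ₗ[S] X, f ∘ₗ ψ = φ := by
  have hmem : ∀ x, φ x ∈ LinearMap.range f := fun x => (hfg _).1 (LinearMap.congr_fun h x)
  refine ⟨(LinearEquiv.ofInjective f hf).symm.toLinearMap ∘ₗ φ.codRestrict _ hmem,
    LinearMap.ext fun x => ?_⟩
  exact congrArg Subtype.val ((LinearEquiv.ofInjective f hf).apply_symm_apply ⟨φ x, hmem x⟩)

theorem map_exact {f : X →ₗ[S] Y} {g : Y →ₗ[S] Z} (hf : Function.Injective f)
    (hfg : Function.Exact f g) : Function.Exact (map M f) (map M g) := by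
  intro φ
  refine ⟨fun h => exists_comp_eq hf hfg h, ?_⟩
  rintro ⟨ψ, rfl⟩
  exact LinearMap.ext fun x => hfg.apply_apply_eq_zero _

theorem isModuleRetract_map (h : IsModuleRetract S X Y) :
    IsModuleRetract (Module.End S M)ᵐᵒᵖ (HomFrom S M X) (HomFrom S M Y) := by
  obtain ⟨i, r, h⟩ := h
  exact ⟨map M i, map M r, LinearMap.ext fun φ => LinearMap.ext fun x =>
    LinearMap.congr_fun h (φ.hom x)⟩

/-- `Hom(M, M^n)` is free of rank `n`, and direct summands are preserved. -/
theorem projective_of_inAdd (h : InAdd S M X) :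
    Module.Projective (Module.End S M)ᵐᵒᵖ (HomFrom S M X) := by
  obtain ⟨n, i, r, h⟩ := h
  let a : HomFrom S M X →ₗ[(Module.End S M)ᵐᵒᵖ] (Fin n → (Module.End S M)ᵐᵒᵖ) :=
    { toFun := fun φ j => MulOpposite.op (LinearMap.proj j ∘ₗ i ∘ₗ φ.hom)
      map_add' := fun φ ψ => funext fun j => MulOpposite.unop_injective
        (LinearMap.ext fun x => congrFun (map_add i (φ.hom x) (ψ.hom x)) j)
      map_smul' := fun _ _ => rfl }
  let b : (Fin n → (Module.End S M)ᵐᵒᵖ) →ₗ[(Module.End S M)ᵐᵒᵖ] HomFrom S M X :=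
    { toFun := fun γ => r ∘ₗ LinearMap.pi fun j => (γ j).unop
      map_add' := fun γ δ => LinearMap.ext fun x =>
        map_add r (fun j => (γ j).unop x) (fun j => (δ j).unop x)
      map_smul' := fun _ _ => rfl }
  exact Module.Projective.of_split a b (LinearMap.ext fun φ => LinearMap.ext fun x =>
    LinearMap.congr_fun h (φ.hom x))

end HomFrom

end HomFrom

/-! ### Non-split self-extensions and the infinite projective dimension. -/

section SelfExtension

variable {S : Type u} [Ring S] {N N' : Type u} [AddCommGroup N] [Module S N]
  [AddCommGroup N'] [Module S N'] {u : N →ₗ[S] N'} {v : N' →ₗ[S] N}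

theorem exists_comp_eq_of_surjective {X Y Z : Type u} [AddCommGroup X] [Module S X]
    [AddCommGroup Y] [Module S Y] [AddCommGroup Z] [Module S Z] {f : X →ₗ[S] Y} {g : Y →ₗ[S] Z}
    (hfg : Function.Exact f g) (hg : Function.Surjective g) {W : Type u} [AddCommGroup W]
    [Module S W] {φ : Y →ₗ[S] W} (h : φ ∘ₗ f = 0) : ∃ ψ : Z →ₗ[S] W, ψ ∘ₗ g = φ := by
  have hle : LinearMap.ker g ≤ LinearMap.ker φ := fun y hy => by
    obtain ⟨x, rfl⟩ := (hfg y).1 hy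
    exact LinearMap.congr_fun h x
  refine ⟨(LinearMap.ker g).liftQ φ hle ∘ₗ (g.quotKerEquivOfSurjective hg).symm.toLinearMap,
    LinearMap.ext fun y => ?_⟩
  have : (g.quotKerEquivOfSurjective hg).symm (g y) = Submodule.Quotient.mk y := by
    rw [LinearEquiv.symm_apply_eq]
    rfl
  simp only [LinearMap.comp_apply, LinearEquiv.coe_coe, this]
  exact Submodule.liftQ_apply _ _ _

/-- A non-split self-extension of a module whose endomorphism ring is a division ring. -/
structure IsNonsplitSelfExtension (u : N →ₗ[S] N') (v : N' →ₗ[S] N) : Prop where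
  nontrivial : Nontrivial N
  isUnit : ∀ f : Module.End S N, f ≠ 0 → IsUnit f
  injective : Function.Injective u
  exact : Function.Exact u v
  surjective : Function.Surjective v
  nonsplit : ¬ ∃ s : N →ₗ[S] N', v ∘ₗ s = LinearMap.id

namespace IsNonsplitSelfExtension

theorem nonsplit' (h : IsNonsplitSelfExtension u v) :
    ¬ ∃ l : N' →ₗ[S] N, l ∘ₗ u = LinearMap.id := by
  rintro ⟨l, hl⟩
  have h0 : (LinearMap.id - u ∘ₗ l) ∘ₗ u = 0 := by
    rw [LinearMap.sub_comp, LinearMap.comp_assoc, hl]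
    exact sub_self _
  obtain ⟨s, hs⟩ := exists_comp_eq_of_surjective h.exact h.surjective h0
  refine h.nonsplit ⟨s, LinearMap.ext fun x => ?_⟩
  obtain ⟨y, rfl⟩ := h.surjective x
  have h1 : s (v y) = y - u (l y) := LinearMap.congr_fun hs y
  simp [h1, h.exact.apply_apply_eq_zero]

theorem exists_comp_eq_id {X : Type u} [AddCommGroup X] [Module S X]
    (h : IsNonsplitSelfExtension u v) {f : X →ₗ[S] N} {g : N →ₗ[S] X} (h0 : f ∘ₗ g ≠ 0) :
    ∃ w : N →ₗ[S] N, f ∘ₗ g ∘ₗ w = LinearMap.id ∧ w ∘ₗ f ∘ₗ g = LinearMap.id := by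
  obtain ⟨w, hw⟩ := h.isUnit (f ∘ₗ g) h0
  have h1 := w.mul_inv
  have h2 := w.inv_mul
  rw [hw] at h1 h2
  exact ⟨(w⁻¹ : (Module.End S N)ˣ), h1, h2⟩

/-- Otherwise `g ∘ₗ u` would be invertible in `End N`, giving a retraction of `u`. -/
theorem comp_eq_zero (h : IsNonsplitSelfExtension u v) (g : N' →ₗ[S] N) : g ∘ₗ u = 0 := by
  by_contra h0
  obtain ⟨w, -, hw⟩ := h.exists_comp_eq_id h0
  exact h.nonsplit' ⟨w ∘ₗ g, hw⟩

theorem exists_eq_comp (h : IsNonsplitSelfExtension u v) (g : N' →ₗ[S] N) :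
    ∃ a : N →ₗ[S] N, a ∘ₗ v = g :=
  exists_comp_eq_of_surjective h.exact h.surjective (h.comp_eq_zero g)

/-- An endomorphism `t` induces `b` on the submodule `N` and `a` on the quotient `N`. If `a ≠ 0`,
then `b ≠ 0` as well, since otherwise `t` factors through `v` and `v` splits. Both are then
invertible, and so is `t`, by a diagram chase. -/
theorem isUnit_or_comp_eq_zero (h : IsNonsplitSelfExtension u v) (t : Module.End S N') :
    IsUnit t ∨ v ∘ₗ t = 0 := by
  by_contra hcon
  push Not at hcon
  obtain ⟨ht, h0⟩ := hcon
  obtain ⟨a, ha⟩ := h.exists_eq_comp (v ∘ₗ t)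
  have ha0 : a ≠ 0 := by
    rintro rfl
    exact h0 (by rw [← ha, LinearMap.zero_comp])
  obtain ⟨b, hb⟩ := HomFrom.exists_comp_eq h.injective h.exact (φ := t ∘ₗ u) (by
    rw [← LinearMap.comp_assoc]
    exact h.comp_eq_zero _)
  have hb0 : b ≠ 0 := by
    rintro rfl
    obtain ⟨s, hs⟩ := exists_comp_eq_of_surjective h.exact h.surjective (φ := t)
      (by rw [← hb, LinearMap.comp_zero])
    have hvs : v ∘ₗ s = a := by
      refine LinearMap.ext fun x => ?_
      obtain ⟨y, rfl⟩ := h.surjective x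
      have h1 : s (v y) = t y := LinearMap.congr_fun hs y
      have h2 : a (v y) = v (t y) := LinearMap.congr_fun ha y
      simp [h1, h2]
    obtain ⟨w, hw, -⟩ := h.exists_comp_eq_id (hvs ▸ ha0)
    exact h.nonsplit ⟨s ∘ₗ w, hw⟩
  have hav : ∀ y, a (v y) = v (t y) := LinearMap.congr_fun ha
  have hbu : ∀ y, u (b y) = t (u y) := LinearMap.congr_fun hb
  have haB := (Module.End.isUnit_iff _).1 (h.isUnit a ha0)
  have hbB := (Module.End.isUnit_iff _).1 (h.isUnit b hb0)
  refine ht ((Module.End.isUnit_iff _).2 ⟨?_, fun y => ?_⟩)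
  · rw [← LinearMap.ker_eq_bot, LinearMap.ker_eq_bot']
    intro x hx
    have h1 : v x = 0 := haB.1 (by rw [hav, hx, map_zero, map_zero])
    obtain ⟨z, rfl⟩ := (h.exact x).1 h1
    rw [← hbu, ← map_zero u] at hx
    rw [hbB.1 ((h.injective hx).trans (map_zero b).symm), map_zero]
  · obtain ⟨c, hc⟩ := haB.2 (v y)
    obtain ⟨x, rfl⟩ := h.surjective c
    obtain ⟨z, hz⟩ := (h.exact (y - t x)).1 (by rw [map_sub, ← hav, hc, sub_self])
    obtain ⟨z, rfl⟩ := hbB.2 z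
    exact ⟨x + u z, by rw [map_add, ← hbu, hz, add_sub_cancel]⟩

end IsNonsplitSelfExtension

/-- The family `f` generates `Hom(X, Y)` as a right module over the endomorphism ring of `X`. -/
def GeneratesHom {S : Type u} [Ring S] {X Y : Type u} [AddCommGroup X] [Module S X]
    [AddCommGroup Y] [Module S Y] (r : ℕ) (f : Fin r → (X →ₗ[S] Y)) : Prop :=
  ∀ φ : X →ₗ[S] Y, ∃ t : Fin r → Module.End S X, φ = ∑ i, f i ∘ₗ t i

/-- In a family of least cardinality, a relation with an invertible coefficient would make one
generator redundant. -/
theorem exists_generatesHom_minimal (h : ∃ (r : ℕ) (f : Fin r → (N' →ₗ[S] N)), GeneratesHom r f) :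
    ∃ (r : ℕ) (f : Fin r → (N' →ₗ[S] N)), GeneratesHom r f ∧
      ∀ t : Fin r → Module.End S N', ∑ i, f i ∘ₗ t i = 0 → ∀ i, ¬ IsUnit (t i) := by
  classical
  obtain ⟨f, hf⟩ := Nat.find_spec h
  refine ⟨Nat.find h, f, hf, ?_⟩
  have hmin : ∀ m < Nat.find h, ¬ ∃ f : Fin m → (N' →ₗ[S] N), GeneratesHom m f :=
    fun m hm => Nat.find_min h hm
  generalize Nat.find h = r at *
  intro t ht j hj
  obtain _ | r := r
  · exact j.elim0
  obtain ⟨w, hw⟩ := hj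
  rw [Fin.sum_univ_succAbove _ j] at ht
  have hfj : f j = ∑ i, f (j.succAbove i) ∘ₗ (-(t (j.succAbove i) ∘ₗ (w⁻¹ :
      (Module.End S N')ˣ).val)) := by
    have h1 : f j = (f j ∘ₗ t j) ∘ₗ (w⁻¹ : (Module.End S N')ˣ).val := by
      have := w.mul_inv
      rw [hw] at this
      rw [LinearMap.comp_assoc]
      exact (congrArg (f j ∘ₗ ·) this).symm
    rw [h1, eq_neg_of_add_eq_zero_left ht]
    ext x
    simp
  refine hmin r (Nat.lt_succ_self r) ⟨fun i => f (j.succAbove i), fun φ => ?_⟩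
  obtain ⟨s, rfl⟩ := hf φ
  refine ⟨fun i => s (j.succAbove i) - (t (j.succAbove i) ∘ₗ (w⁻¹ : (Module.End S N')ˣ).val) ∘ₗ
    s j, ?_⟩
  rw [Fin.sum_univ_succAbove _ j]
  conv_lhs => rw [hfj]
  ext x
  simp [sub_eq_add_neg, Finset.sum_add_distrib, add_comm]

variable {C Z P : Type u} [AddCommGroup C] [Module S C] [AddCommGroup Z] [Module S Z]
  [AddCommGroup P] [Module S P]

/-- Maps from `C` and `P` lift by projectivity and those from `Z` vanish, so only the component on
`N'` can obstruct a lift. -/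
theorem exists_lift_of_components {X Y : Type u} [AddCommGroup X] [Module S X]
    [AddCommGroup Y] [Module S Y] [Module.Projective S C] [Module.Projective S P]
    {g : X →ₗ[S] Y} (hg : Function.Surjective g) (hZ : ∀ φ : Z →ₗ[S] Y, φ = 0)
    (φ : C × Z × P × N' →ₗ[S] Y)
    (hN' : ∃ ψ : N' →ₗ[S] X, g ∘ₗ ψ = φ ∘ₗ LinearMap.inr S C (Z × P × N') ∘ₗ
      LinearMap.inr S Z (P × N') ∘ₗ LinearMap.inr S P N') :
    ∃ ψ : C × Z × P × N' →ₗ[S] X, g ∘ₗ ψ = φ := by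
  obtain ⟨d, hd⟩ := hN'
  obtain ⟨a, ha⟩ := Module.projective_lifting_property g (φ ∘ₗ LinearMap.inl S C (Z × P × N')) hg
  obtain ⟨c, hc⟩ := Module.projective_lifting_property g (φ ∘ₗ LinearMap.inr S C (Z × P × N') ∘ₗ
    LinearMap.inr S Z (P × N') ∘ₗ LinearMap.inl S P N') hg
  refine ⟨a.coprod (LinearMap.coprod 0 (c.coprod d)), LinearMap.ext fun x => ?_⟩
  obtain ⟨x1, x2, x3, x4⟩ := x
  have h1 : g (a x1) = φ (x1, 0) := LinearMap.congr_fun ha x1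
  have h2 : φ (0, x2, 0) = 0 := LinearMap.congr_fun (hZ (φ ∘ₗ LinearMap.inr S C (Z × P × N') ∘ₗ
    LinearMap.inl S Z (P × N'))) x2
  have h3 : g (c x3) = φ (0, 0, x3, 0) := LinearMap.congr_fun hc x3
  have h4 : g (d x4) = φ (0, 0, 0, x4) := LinearMap.congr_fun hd x4
  have h5 : ((x1, x2, x3, x4) : C × Z × P × N') =
      (x1, 0) + ((0, x2, 0) + ((0, 0, x3, 0) + (0, 0, 0, x4))) := by simp
  rw [h5, map_add φ, map_add φ, map_add φ, h2, ← h1, ← h3, ← h4]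
  simp

theorem IsNonsplitSelfExtension.not_projective_homFrom (h : IsNonsplitSelfExtension u v)
    [Module.Projective S C] [Module.Projective S P] (hZ : ∀ φ : Z →ₗ[S] N, φ = 0) :
    ¬ Module.Projective (Module.End S (C × Z × P × N'))ᵐᵒᵖ (HomFrom S (C × Z × P × N') N) := by
  intro hproj
  obtain ⟨s, hs⟩ := Module.projective_def'.1 hproj
  let p : C × Z × P × N' →ₗ[S] N' := LinearMap.snd S P N' ∘ₗ LinearMap.snd S Z (P × N') ∘ₗ
    LinearMap.snd S C (Z × P × N')
  let j : N' →ₗ[S] C × Z × P × N' := LinearMap.inr S C (Z × P × N') ∘ₗ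
      LinearMap.inr S Z (P × N') ∘ₗ LinearMap.inr S P N'
  have hpj : p ∘ₗ j = LinearMap.id := rfl
  let x : HomFrom S (C × Z × P × N') N := v ∘ₗ p
  let ε : Module.End S (C × Z × P × N') := j ∘ₗ u ∘ₗ v ∘ₗ p
  have hxε : MulOpposite.op ε • x = 0 := by
    refine LinearMap.ext fun y => ?_
    exact h.exact.apply_apply_eq_zero _
  -- The relation `hxε` makes each coefficient of `s x` vanish on `j (u N)`, so its restriction to
  -- `N'` factors through `v`.
  have key : ∀ y : HomFrom S (C × Z × P × N') N, ∃ c : N →ₗ[S] C × Z × P × N',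
      c ∘ₗ v = (s x y).unop ∘ₗ j := fun y => by
    apply exists_comp_eq_of_surjective h.exact h.surjective
    have h1 : (s (MulOpposite.op ε • x)) y = 0 := by rw [hxε, map_zero]; rfl
    rw [map_smul] at h1
    have h2 : (s x y).unop ∘ₗ ε = 0 := congrArg MulOpposite.unop h1
    refine LinearMap.ext fun n => ?_
    obtain ⟨n, rfl⟩ := h.surjective n
    exact LinearMap.congr_fun h2 (j n)
  choose c hc using key
  have hone : ∑ y ∈ (s x).support, y.hom ∘ₗ c y =
      LinearMap.id := by
    have h1 : Finsupp.linearCombination _ id (s x) = x := LinearMap.congr_fun hs x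
    rw [Finsupp.linearCombination_apply, Finsupp.sum] at h1
    refine LinearMap.ext fun n => ?_
    obtain ⟨n, rfl⟩ := h.surjective n
    have h2 : (∑ y ∈ (s x).support, (s x y) • id y : HomFrom S (C × Z × P × N') N).hom
      (j n) = v n := LinearMap.congr_fun h1 (j n)
    rw [← LinearMap.comp_apply, LinearMap.id_apply, ← h2]
    let ev : HomFrom S (C × Z × P × N') N →+ N :=
      (LinearMap.applyₗ' ℕ (j n)).toAddMonoidHom
    rw [LinearMap.comp_apply, LinearMap.sum_apply]
    refine Eq.trans ?_ (map_sum ev _ _).symm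
    refine Finset.sum_congr rfl fun y _ => ?_
    exact congrArg y.hom (LinearMap.congr_fun (hc y) n)
  -- Some term of `hone` is nonzero, hence an automorphism, so `c y` embeds `N` as a summand of `M`.
  -- The rest turns this into a section of `v`.
  obtain ⟨y, -, hy⟩ : ∃ y ∈ (s x).support,
      y.hom ∘ₗ c y ≠ 0 := by
    by_contra! hall
    rw [Finset.sum_eq_zero hall] at hone
    have := h.nontrivial
    obtain ⟨n, hn⟩ := exists_ne (0 : N)
    exact hn (LinearMap.congr_fun hone n).symm
  obtain ⟨w, hw, -⟩ := h.exists_comp_eq_id hy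
  -- With its component on `N'` removed, `y` lifts through `v`. The removed part vanishes on `c y`,
  -- because it factors through `v ∘ₗ p ∘ₗ c y = 0`.
  obtain ⟨t, ht⟩ := exists_lift_of_components h.surjective hZ (y.hom - y.hom ∘ₗ j ∘ₗ p)
    ⟨0, by
      change v ∘ₗ 0 = (y.hom - y.hom ∘ₗ j ∘ₗ p) ∘ₗ j
      rw [LinearMap.comp_zero, LinearMap.sub_comp]
      exact (sub_self _).symm⟩
  have hvpc : v ∘ₗ (p ∘ₗ c y) = 0 := by
    by_contra h0
    obtain ⟨w', hw', -⟩ := h.exists_comp_eq_id h0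
    exact h.nonsplit ⟨_, hw'⟩
  obtain ⟨a, ha⟩ := h.exists_eq_comp (y.hom ∘ₗ j)
  have h1 : ∀ n, y.hom (j (p (c y n))) = 0 := fun n => by
    have h2 : a (v (p (c y n))) = y.hom (j (p (c y n))) := LinearMap.congr_fun ha _
    have h3 : v (p (c y n)) = 0 := LinearMap.congr_fun hvpc n
    rw [← h2, h3, map_zero]
  refine h.nonsplit ⟨t ∘ₗ c y ∘ₗ w, LinearMap.ext fun n => ?_⟩
  have h4 : v (t (c y (w n))) = y.hom (c y (w n)) - y.hom (j (p (c y (w n)))) :=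
    LinearMap.congr_fun ht _
  rw [h1, _root_.sub_zero] at h4
  exact h4.trans (LinearMap.congr_fun hw n)

/-- Let `M` be the direct sum of the middle term of a non-split self-extension of `N`, of projective
modules, and of a module without nonzero maps to `N`. Under finiteness conditions, `Hom(M, N)` has
infinite projective dimension over the endomorphism ring of `M`. -/
theorem IsNonsplitSelfExtension.projectiveDimension_homFrom (h : IsNonsplitSelfExtension u v)
    [Module.Projective S C] [Module.Projective S P] (hZ : ∀ φ : Z →ₗ[S] N, φ = 0)
    (hgen : ∃ (r : ℕ) (f : Fin r → (N' →ₗ[S] N)), GeneratesHom r f)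
    (hres : ∀ (n : ℕ) (X : Submodule S (Fin n → N)), ∃ (l : ℕ) (q : (Fin l → C) →ₗ[S] X),
      Function.Surjective q ∧ InAdd S C (LinearMap.ker q)) :
    CategoryTheory.projectiveDimension (ModuleCat.of (Module.End S (C × Z × P × N'))ᵐᵒᵖ
      (HomFrom S (C × Z × P × N') N)) = ⊤ := by
  refine projectiveDimension_eq_top (h.not_projective_homFrom hZ) fun d hd => ?_
  obtain ⟨r, f, hf, hmin⟩ := exists_generatesHom_minimal hgen
  let Φ : (Fin r → N') →ₗ[S] N := ∑ i, f i ∘ₗ LinearMap.proj i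
  have hΦ : ∀ x, Φ x = ∑ i, f i (x i) := fun x => by simp [Φ]
  have hΦlift : ∀ φ : N' →ₗ[S] N, ∃ ψ : N' →ₗ[S] (Fin r → N'), Φ ∘ₗ ψ = φ := fun φ => by
    obtain ⟨t, rfl⟩ := hf φ
    exact ⟨LinearMap.pi t, LinearMap.ext fun x => by simp [hΦ]⟩
  have hΦsurj : Function.Surjective Φ := fun x => by
    obtain ⟨ψ, hψ⟩ := hΦlift v
    obtain ⟨y, rfl⟩ := h.surjective x
    exact ⟨ψ y, LinearMap.congr_fun hψ y⟩
  -- Needed at the end, where `N` is recovered as a summand of `N^r`.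
  have hr : Nonempty (Fin r) := by
    by_contra hr
    rw [not_nonempty_iff] at hr
    have := h.nontrivial
    obtain ⟨n, hn⟩ := exists_ne (0 : N)
    obtain ⟨x, hx⟩ := hΦsurj n
    exact hn (by rw [← hx, hΦ, Finset.univ_eq_empty, Finset.sum_empty])
  obtain ⟨i₀⟩ := hr
  let K := LinearMap.ker Φ
  let ι : (Fin r → N) →ₗ[S] K := (LinearMap.pi fun i => u ∘ₗ LinearMap.proj i).codRestrict K
    fun x => by
      rw [LinearMap.mem_ker, hΦ]
      exact Finset.sum_eq_zero fun i _ => LinearMap.congr_fun (h.comp_eq_zero (f i)) (x i)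
  let π : K →ₗ[S] (Fin r → N) := LinearMap.pi fun i => v ∘ₗ LinearMap.proj i ∘ₗ K.subtype
  let X := LinearMap.range π
  let π' : K →ₗ[S] X := π.rangeRestrict
  have hπ' : Function.Surjective π' := π.surjective_rangeRestrict
  have hι : Function.Injective ι := fun x y hxy => funext fun i =>
    h.injective (congrFun (congrArg Subtype.val hxy) i)
  have hιπ : Function.Exact ι π' := by
    intro x
    constructor
    · intro hx
      have h1 : ∀ i, v (x.1 i) = 0 := fun i => congrFun (congrArg Subtype.val hx) i
      choose y hy using fun i => (h.exact (x.1 i)).1 (h1 i)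
      exact ⟨y, Subtype.ext (funext hy)⟩
    · rintro ⟨y, rfl⟩
      exact Subtype.ext (funext fun i => h.exact.apply_apply_eq_zero (y i))
  obtain ⟨l, q, hq, hqker⟩ := hres r X
  let M := C × Z × P × N'
  let Γ := (Module.End S M)ᵐᵒᵖ
  have hN'add : InAdd S M (Fin r → N') :=
    InAdd.of_isModuleRetract ⟨r, LinearMap.id, LinearMap.id, rfl⟩
      ⟨LinearMap.inr S C (Z × P × N') ∘ₗ LinearMap.inr S Z (P × N') ∘ₗ LinearMap.inr S P N',
        LinearMap.snd S P N' ∘ₗ LinearMap.snd S Z (P × N') ∘ₗ LinearMap.snd S C (Z × P × N'), rfl⟩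
  have hCadd : ∀ Y : Type u, ∀ [AddCommGroup Y] [Module S Y], InAdd S C Y → InAdd S M Y :=
    fun Y _ _ hY => hY.of_isModuleRetract
      ⟨LinearMap.inl S C (Z × P × N'), LinearMap.fst S C (Z × P × N'), rfl⟩
  have hZX : ∀ φ : Z →ₗ[S] X, φ = 0 := fun φ => LinearMap.ext fun z => Subtype.ext <|
    funext fun i => LinearMap.congr_fun (hZ (LinearMap.proj i ∘ₗ X.subtype ∘ₗ φ)) z
  have hFK : ProjDimLT Γ (HomFrom S M K) (d + 1) := by
    have hp : ProjDimLT Γ (HomFrom S M (Fin r → N')) (d + 1) :=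
      (projDimLT_one_iff.2 (HomFrom.projective_of_inAdd hN'add)).mono (Nat.le_add_left _ _)
    refine hp.left hd (f := HomFrom.map M K.subtype) (g := HomFrom.map M Φ)
      (HomFrom.map_injective K.subtype_injective)
      (HomFrom.map_exact K.subtype_injective (LinearMap.exact_subtype_ker_map Φ)) fun φ => ?_
    exact exists_lift_of_components hΦsurj hZ φ (hΦlift _)
  -- `Hom(M, K) → Hom(M, X)` need not be onto, so the exact sequence ends in its image `L`.
  let L := LinearMap.range (HomFrom.map M π')
  have hL : ProjDimLT Γ L 2 := by
    have h1 : ProjDimLT Γ (HomFrom S M (LinearMap.ker q)) 1 :=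
      projDimLT_one_iff.2 (HomFrom.projective_of_inAdd (hCadd _ hqker))
    have h2 : ProjDimLT Γ (HomFrom S M (Fin l → C)) 2 :=
      (projDimLT_one_iff.2 (HomFrom.projective_of_inAdd (hCadd _
        ⟨l, LinearMap.id, LinearMap.id, rfl⟩))).mono (by norm_num)
    -- `C^l` is projective, so `q` lifts through `π'` and its composites lie in `L`.
    have hmem : ∀ φ, HomFrom.map M q φ ∈ L := fun φ => by
      have : Module.Projective S (Fin l → C) :=
        Module.Projective.of_equiv (DFinsupp.linearEquivFunOnFintype (R := S) (M := fun _ : Fin l => C))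
      obtain ⟨q', hq'⟩ := Module.projective_lifting_property π' q hπ'
      exact ⟨HomFrom.map M q' φ, LinearMap.ext fun x => LinearMap.congr_fun hq' (φ.hom x)⟩
    have hex := HomFrom.map_exact (M := M) (LinearMap.ker q).subtype_injective
      (LinearMap.exact_subtype_ker_map q)
    refine h1.right h2 (f := HomFrom.map M (LinearMap.ker q).subtype)
      (g := (HomFrom.map M q).codRestrict L hmem)
      (HomFrom.map_injective (LinearMap.ker q).subtype_injective) (fun φ => ?_) ?_
    · rw [← hex φ]
      exact Subtype.ext_iff
    · rintro ⟨_, ψ, rfl⟩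
      -- Conversely, elements of `L` lift through `q`: minimality of `f` kills their component on
      -- `N'`, which therefore lifts by zero.
      obtain ⟨χ, hχ⟩ := exists_lift_of_components (C := C) (Z := Z) (P := P) (N' := N') hq hZX
        (π' ∘ₗ ψ.hom) ⟨0, by
          rw [LinearMap.comp_zero]
          refine LinearMap.ext fun x => Subtype.ext (funext fun i => ?_)
          let t : Fin r → Module.End S N' := fun i => LinearMap.proj i ∘ₗ K.subtype ∘ₗ ψ.hom ∘ₗ
            LinearMap.inr S C (Z × P × N') ∘ₗ LinearMap.inr S Z (P × N') ∘ₗ LinearMap.inr S P N'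
          have ht : ∑ i, f i ∘ₗ t i = 0 := LinearMap.ext fun x => by
            have h1 := (ψ.hom (0, 0, 0, x)).2
            rw [LinearMap.mem_ker, hΦ] at h1
            rw [LinearMap.sum_apply]
            exact h1
          have h2 := (h.isUnit_or_comp_eq_zero (t i)).resolve_left (hmin t ht i)
          exact (LinearMap.congr_fun h2 x).symm⟩
      exact ⟨χ, Subtype.ext hχ⟩
  have hFN : ProjDimLT Γ (HomFrom S M (Fin r → N)) (d + 1) := by
    have hex := HomFrom.map_exact (M := M) hι hιπ
    refine hFK.left (hL.mono (Nat.le_add_left _ _)) (f := HomFrom.map M ι)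
      (g := (HomFrom.map M π').rangeRestrict) (HomFrom.map_injective hι) (fun φ => ?_)
      (LinearMap.surjective_rangeRestrict _)
    rw [← hex φ]
    exact Subtype.ext_iff
  exact hFN.of_retract (HomFrom.isModuleRetract_map
    ⟨LinearMap.single S (fun _ => N) i₀, LinearMap.proj i₀, LinearMap.ext fun x => by simp⟩)

end SelfExtension

/-! ### Duals of left ideals generated by idempotents. -/

section Coinduced

variable {k : Type u} [CommRing k] {E : Type u} [AddCommGroup E] [Module k E]
  {R : Type u} [Ring R] [Algebra k R] {W : Type u} [AddCommGroup W] [Module Rᵐᵒᵖ W]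

open MulOpposite

/-- The functional `ε` identifies the right module `W` with the dual of the left ideal `R e`, for an
idempotent `e`, through `w ↦ (r e ↦ ε (w r))`. -/
structure IsDualOfLeftIdeal (e : R) (ε : W →+ E) : Prop where
  smul : ∀ (c : k) w, ε (op (algebraMap k R c) • w) = c • ε w
  idem : ∀ w, ε (op e • w) = ε w
  ext : ∀ w, (∀ r : R, ε (op r • w) = 0) → w = 0
  exists_eq : ∀ Λ : R →ₗ[k] E, ∃ w, ∀ r, ε (op r • w) = Λ (r * e)

/-- Coinduction: a `k`-linear functional `l` on `X` yields the map to `W` sending `x` to the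
functional `r e ↦ l (x r e)`. -/
theorem IsDualOfLeftIdeal.exists_lift {e : R} {ε : W →+ E}
    (h : IsDualOfLeftIdeal (k := k) e ε) {X : Type u} [AddCommGroup X] [Module Rᵐᵒᵖ X] (l : X →+ E)
    (hl : ∀ (c : k) x, l (op (algebraMap k R c) • x) = c • l x) :
    ∃ φ : X →ₗ[Rᵐᵒᵖ] W, ∀ x, ε (φ x) = l (op e • x) := by
  let Λ : X → (R →ₗ[k] E) := fun x =>
    { toFun := fun r => l (op r • x)
      map_add' := fun r s => by rw [op_add, add_smul, map_add]
      map_smul' := fun c r => by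
        rw [Algebra.smul_def, Algebra.commutes, op_mul, mul_smul, hl]
        rfl }
  choose w hw using fun x => h.exists_eq (Λ x)
  replace hw : ∀ x r, ε (op r • w x) = l (op (r * e) • x) := hw
  refine ⟨{ toFun := w, map_add' := fun x y => ?_, map_smul' := fun s x => ?_ }, fun x => ?_⟩
  · rw [← sub_eq_zero]
    refine h.ext _ fun r => ?_
    rw [smul_sub, smul_add, map_sub, map_add, hw, hw, hw, smul_add, map_add, sub_self]
  · rw [← sub_eq_zero]
    refine h.ext _ fun r => ?_
    have h1 : op r • s • w x = op (s.unop * r) • w x := by rw [op_mul, mul_smul]; rfl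
    have h2 : op (r * e) • s • x = op (s.unop * r * e) • x := by
      rw [mul_assoc, op_mul s.unop, mul_smul]
      rfl
    rw [RingHom.id_apply, smul_sub, map_sub, h1, hw, hw, h2, sub_self]
  · have := hw x 1
    rwa [op_one, one_smul, one_mul] at this

/-- Extend `ε ∘ p` to a functional on `Y` by injectivity of `E`, then coinduce; `idem` and `ext`
show that the result extends `p`. -/
theorem IsDualOfLeftIdeal.injective {e : R} {ε : W →+ E} (h : IsDualOfLeftIdeal (k := k) e ε)
    (hE : Module.Injective k E) : Module.Injective Rᵐᵒᵖ W := by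
  refine ⟨fun X Y _ _ _ _ f hf p => ?_⟩
  let _ : Module k X := Module.compHom X (algebraMap k Rᵐᵒᵖ)
  let _ : Module k Y := Module.compHom Y (algebraMap k Rᵐᵒᵖ)
  let f' : X →ₗ[k] Y :=
    { toFun := f, map_add' := map_add f, map_smul' := fun c x => map_smul f (algebraMap k Rᵐᵒᵖ c) x }
  let l : X →ₗ[k] E :=
    { toFun := fun x => ε (p x)
      map_add' := fun x y => by rw [map_add, map_add]
      map_smul' := fun c x => (congrArg ε (map_smul p (algebraMap k Rᵐᵒᵖ c) x)).trans (h.smul c _) }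
  obtain ⟨l', hl'⟩ := hE.out f' hf l
  replace hl' : ∀ x, l' (f x) = ε (p x) := hl'
  obtain ⟨φ, hφ⟩ := h.exists_lift l'.toAddMonoidHom (fun c y => l'.map_smul c y)
  replace hφ : ∀ y, ε (φ y) = l' (op e • y) := hφ
  refine ⟨φ, fun x => ?_⟩
  rw [← sub_eq_zero]
  refine h.ext _ fun r => ?_
  rw [smul_sub, map_sub, ← map_smul, ← map_smul f, hφ, ← map_smul f, hl', map_smul p, h.idem,
    map_smul, sub_self]

end Coinduced

/-! ### Consequences of heredity, and finiteness of Hom. -/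

section Hereditary

variable {A : Type u} [Ring A]

/-- The image of `U` in one coordinate is a right ideal, hence projective and split off; the kernel
embeds in `A^n`. -/
theorem IsHereditaryRing.projective_submodule (h : IsHereditaryRing A) :
    ∀ (n : ℕ) (U : Submodule Aᵐᵒᵖ (Fin n → A)), Module.Projective Aᵐᵒᵖ U
  | 0, U => Module.Projective.of_split (R := Aᵐᵒᵖ) (M := Aᵐᵒᵖ) 0 0 (Subsingleton.elim _ _)
  | n + 1, U => by
    let p : U →ₗ[Aᵐᵒᵖ] A := LinearMap.proj 0 ∘ₗ U.subtype
    have : Module.Projective Aᵐᵒᵖ (LinearMap.range p) := h _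
    obtain ⟨s, hs⟩ := Module.projective_lifting_property p.rangeRestrict LinearMap.id
      p.surjective_rangeRestrict
    let t : LinearMap.ker p →ₗ[Aᵐᵒᵖ] (Fin n → A) :=
      (LinearMap.pi fun i => LinearMap.proj i.succ) ∘ₗ U.subtype ∘ₗ (LinearMap.ker p).subtype
    have ht : Function.Injective t := fun x y hxy => Subtype.ext (Subtype.ext (funext fun i => by
      refine Fin.cases ?_ (fun i => congrFun hxy i) i
      exact (LinearMap.mem_ker.1 x.2).trans (LinearMap.mem_ker.1 y.2).symm))
    have : Module.Projective Aᵐᵒᵖ (LinearMap.range t) := h.projective_submodule n _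
    have : Module.Projective Aᵐᵒᵖ (LinearMap.ker p) :=
      Module.Projective.of_equiv (LinearEquiv.ofInjective t ht).symm
    have hps : ∀ z, p (s z) = z := fun z => congrArg Subtype.val (LinearMap.congr_fun hs z)
    refine Module.Projective.of_split (M := LinearMap.ker p × LinearMap.range p)
      (LinearMap.prod ((LinearMap.id - s ∘ₗ p.rangeRestrict).codRestrict _ fun x => ?_)
        p.rangeRestrict) (LinearMap.coprod (LinearMap.ker p).subtype s) (LinearMap.ext fun x => ?_)
    · simp
    · rw [LinearMap.mem_ker, LinearMap.sub_apply, map_sub p, LinearMap.comp_apply s, hps]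
      exact sub_self _

/-- Baer's criterion: a map from a right ideal lifts to `Q` because the ideal is projective, and
then extends because `Q` is injective. -/
theorem IsHereditaryRing.injective_range (h : IsHereditaryRing A) {Q X : Type u} [AddCommGroup Q]
    [Module Aᵐᵒᵖ Q] [AddCommGroup X] [Module Aᵐᵒᵖ X] (hQ : Module.Injective Aᵐᵒᵖ Q)
    (f : Q →ₗ[Aᵐᵒᵖ] X) : Module.Injective Aᵐᵒᵖ (LinearMap.range f) := by
  refine Module.Baer.injective fun I g => ?_
  have : Module.Projective Aᵐᵒᵖ (Submodule.comap (opSelfEquiv A).toLinearMap I) := h _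
  have : Module.Projective Aᵐᵒᵖ I := Module.Projective.of_equiv
    ((opSelfEquiv A).submoduleMap (Submodule.comap (opSelfEquiv A).toLinearMap I) |>.trans
      (LinearEquiv.ofEq _ _ (Submodule.map_comap_eq_of_surjective (opSelfEquiv A).surjective I)))
  obtain ⟨g', hg'⟩ := Module.projective_lifting_property f.rangeRestrict g f.surjective_rangeRestrict
  obtain ⟨q, hq⟩ := hQ.out (Submodule.subtype I) (Submodule.subtype_injective I) g'
  refine ⟨f.rangeRestrict ∘ₗ q, fun x hx => ?_⟩
  rw [← hg', LinearMap.comp_apply, LinearMap.comp_apply, ← hq]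
  rfl

theorem IsNonsplitSelfExtension.hom_eq_zero_of_injective (h : IsHereditaryRing A) {N N' Q : Type u}
    [AddCommGroup N] [Module Aᵐᵒᵖ N] [AddCommGroup N'] [Module Aᵐᵒᵖ N'] [AddCommGroup Q]
    [Module Aᵐᵒᵖ Q] {u : N →ₗ[Aᵐᵒᵖ] N'} {v : N' →ₗ[Aᵐᵒᵖ] N} (huv : IsNonsplitSelfExtension u v)
    (hQ : Module.Injective Aᵐᵒᵖ Q) (f : Q →ₗ[Aᵐᵒᵖ] N) : f = 0 := by
  have hI := h.injective_range hQ f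
  by_contra hf
  obtain ⟨r, hr⟩ := hI.out (LinearMap.range f).subtype (Submodule.subtype_injective _) LinearMap.id
  -- The injective image of `f` is a summand; the projection `g` onto it is a nonzero endomorphism
  -- of `N`, hence onto, so `N` itself is injective.
  let g : N →ₗ[Aᵐᵒᵖ] N := (LinearMap.range f).subtype ∘ₗ r
  have hg : ∀ x, g (f x) = f x := fun x => congrArg Subtype.val (hr ⟨f x, x, rfl⟩)
  have hg0 : g ≠ 0 := fun h0 => hf (LinearMap.ext fun x => by rw [← hg, h0]; rfl)
  have hgs := ((Module.End.isUnit_iff _).1 (huv.isUnit g hg0)).2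
  have htop : LinearMap.range f = ⊤ := eq_top_iff.2 fun x _ => by
    obtain ⟨y, rfl⟩ := hgs x
    exact (r y).2
  have hN : Module.Injective Aᵐᵒᵖ N :=
    ((LinearEquiv.ofEq _ _ htop).trans Submodule.topEquiv).symm.isModuleRetract.injective hI
  obtain ⟨l, hl⟩ := hN.out u huv.injective LinearMap.id
  exact huv.nonsplit' ⟨l, LinearMap.ext hl⟩

/-- `Hom(X, Y)` embeds in a finite power of `Y`, so it is already finitely generated over `k`, which
acts through `End X`. -/
theorem exists_generatesHom (k : Type u) [CommRing k] [IsNoetherianRing k] [Algebra k A]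
    [Module.Finite k A] (X Y : Type u) [AddCommGroup X] [Module Aᵐᵒᵖ X] [Module.Finite Aᵐᵒᵖ X]
    [AddCommGroup Y] [Module Aᵐᵒᵖ Y] [Module.Finite Aᵐᵒᵖ Y] :
    ∃ (r : ℕ) (f : Fin r → (X →ₗ[Aᵐᵒᵖ] Y)), GeneratesHom r f := by
  let _ : Module k X := Module.compHom X (algebraMap k Aᵐᵒᵖ)
  let _ : Module k Y := Module.compHom Y (algebraMap k Aᵐᵒᵖ)
  have hX : ∀ (c : k) (x : X), c • x = algebraMap k Aᵐᵒᵖ c • x := fun _ _ => rfl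
  have hY : ∀ (c : k) (x : Y), c • x = algebraMap k Aᵐᵒᵖ c • x := fun _ _ => rfl
  have : IsScalarTower k Aᵐᵒᵖ X := ⟨fun c a x => by rw [hX, Algebra.smul_def, mul_smul]⟩
  have : IsScalarTower k Aᵐᵒᵖ Y := ⟨fun c a x => by rw [hY, Algebra.smul_def, mul_smul]⟩
  have : SMulCommClass Aᵐᵒᵖ k Y := IsScalarTower.to_smulCommClass'
  have : SMulCommClass Aᵐᵒᵖ k X := IsScalarTower.to_smulCommClass'
  have : Module.Finite k Aᵐᵒᵖ := Module.Finite.equiv (MulOpposite.opLinearEquiv k)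
  have : Module.Finite k Y := Module.Finite.trans Aᵐᵒᵖ Y
  obtain ⟨n, g, hg⟩ := Module.Finite.exists_fin' Aᵐᵒᵖ X
  let T : (X →ₗ[Aᵐᵒᵖ] Y) →ₗ[k] (Fin n → Y) :=
    { toFun := fun φ i => φ (g (Pi.single i 1))
      map_add' := fun _ _ => rfl
      map_smul' := fun _ _ => rfl }
  have hT : Function.Injective T := fun φ ψ h => by
    have : φ ∘ₗ g = ψ ∘ₗ g := by
      refine LinearMap.pi_ext' fun i => LinearMap.ext_ring (congrFun h i)
    refine LinearMap.ext fun x => ?_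
    obtain ⟨x, rfl⟩ := hg x
    exact LinearMap.congr_fun this x
  have : Module.Finite k (X →ₗ[Aᵐᵒᵖ] Y) := Module.Finite.of_injective T hT
  obtain ⟨r, f, hf⟩ := Module.Finite.exists_fin (R := k) (M := X →ₗ[Aᵐᵒᵖ] Y)
  refine ⟨r, f, fun φ => ?_⟩
  obtain ⟨c, rfl⟩ := (Submodule.mem_span_range_iff_exists_fun k).1 (hf.ge (Submodule.mem_top (x := φ)))
  refine ⟨fun i => c i • LinearMap.id, Finset.sum_congr rfl fun i _ => LinearMap.ext fun x => ?_⟩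
  exact (map_smul (f i) (algebraMap k Aᵐᵒᵖ (c i)) x).symm

end Hereditary

open MulOpposite

/-! ### The bimodule `DA`: injectivity and biduality. -/

section Dual

variable {k A : Type u} [CommRing k] [Ring A] [Algebra k A]

namespace DualBimodule

noncomputable instance : Module k (DualBimodule k A) :=
  inferInstanceAs (Module k (A →ₗ[k] DualizingModule k))

@[simp] theorem eval_smul_base (c : k) (φ : DualBimodule k A) (x : A) :
    (c • φ).eval x = c • φ.eval x := rfl

theorem eval_smul_right (c : k) (φ : DualBimodule k A) (x : A) :
    φ.eval (c • x) = c • φ.eval x :=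
  map_smul (show A →ₗ[k] DualizingModule k from φ) c x

instance : IsScalarTower k Aᵐᵒᵖ (DualBimodule k A) where
  smul_assoc c a φ := by ext x; simp [eval_smul_right]

/-- The element of `DA` given by a linear map. -/
def ofHom (f : A →ₗ[k] DualizingModule k) : DualBimodule k A := f

@[simp] theorem eval_ofHom (f : A →ₗ[k] DualizingModule k) (x : A) : (ofHom f).eval x = f x := rfl

variable (k A) in
/-- Evaluation at the unit. -/
noncomputable def evalOne : DualBimodule k A →+ DualizingModule k where
  toFun φ := φ.eval 1
  map_zero' := rfl
  map_add' _ _ := rfl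

theorem evalOne_apply (φ : DualBimodule k A) : evalOne k A φ = φ.eval 1 := rfl

theorem algebraMap_smul_eq (c : k) (φ : DualBimodule k A) :
    algebraMap k A c • φ = op (algebraMap k A c) • φ := by
  ext x
  simp [Algebra.commutes]

theorem algebraMap_smul_eq' (c : k) (φ : DualBimodule k A) :
    algebraMap k A c • φ = c • φ := by
  ext x
  rw [eval_smul, ← Algebra.commutes, ← Algebra.smul_def, eval_smul_right, eval_smul_base]

theorem isDualOfLeftIdeal : IsDualOfLeftIdeal (k := k) (1 : A) (evalOne k A) where
  smul c φ := by
    rw [← algebraMap_smul_eq, algebraMap_smul_eq']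
    rfl
  idem φ := by rw [op_one, one_smul]
  ext φ h := by
    ext x
    simpa [evalOne_apply] using h x
  exists_eq Λ := ⟨ofHom Λ, fun r => by
    rw [evalOne_apply, eval_op_smul, eval_ofHom]
    rfl⟩

variable (k) in
theorem injective_dualizingModule : Module.Injective k (DualizingModule k) :=
  (DualizingModule.exists_envelope k).choose_spec.injective

variable (k A) in
theorem injective : Module.Injective Aᵐᵒᵖ (DualBimodule k A) :=
  isDualOfLeftIdeal.injective (injective_dualizingModule k)

theorem eq_zero_of_eval [IsArtinianRing k] {a : A} (h : ∀ φ : DualBimodule k A, φ.eval a = 0) :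
    a = 0 := by
  by_contra h0
  obtain ⟨φ, hφ⟩ := (DualizingModule.exists_envelope k).choose_spec.exists_apply_ne_zero h0
  exact hφ (h φ)

variable [IsArtinianRing k] [Module.Finite k A]

theorem exists_eval_eq (Λ : DualBimodule k A →ₗ[k] DualizingModule k) :
    ∃ a : A, ∀ φ, Λ φ = φ.eval a :=
  (DualizingModule.exists_envelope k).choose_spec.exists_eq_apply Λ

instance finite_base : Module.Finite k (DualBimodule k A) :=
  (DualizingModule.exists_envelope k).choose_spec.finite_hom A

instance finite_right : Module.Finite Aᵐᵒᵖ (DualBimodule k A) :=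
  Module.Finite.of_restrictScalars_finite k _ _

end DualBimodule

end Dual

/-! ### Rows and columns of the replicated algebra. -/

section Replicated

variable {k A : Type u} [CommRing k] [Ring A] [Algebra k A] {m : ℕ}

namespace ReplicatedAlgebra

noncomputable instance : Algebra k (ReplicatedAlgebra k A m) :=
  RingHom.toAlgebra'
    { toFun := fun c => ⟨fun _ => algebraMap k A c, 0⟩
      map_one' := by ext <;> simp
      map_zero' := by ext <;> simp
      map_add' := fun c d => by ext <;> simp
      map_mul' := fun c d => by ext <;> simp }
    fun c r => by
      ext i x
      · exact Algebra.commutes c (r.diag i)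
      · simp [Algebra.commutes]

@[simp] theorem diag_algebraMap (c : k) (i : Fin (m + 1)) :
    (algebraMap k (ReplicatedAlgebra k A m) c).diag i = algebraMap k A c := rfl

@[simp] theorem sub_algebraMap (c : k) :
    (algebraMap k (ReplicatedAlgebra k A m) c).sub = 0 := rfl

@[simp] theorem diag_smul (c : k) (r : ReplicatedAlgebra k A m) : (c • r).diag = c • r.diag := by
  ext i
  simp [Algebra.smul_def]

@[simp] theorem sub_smul (c : k) (r : ReplicatedAlgebra k A m) : (c • r).sub = c • r.sub := by
  ext i x
  rw [Algebra.smul_def, sub_mul, diag_algebraMap, sub_algebraMap,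
    DualBimodule.algebraMap_smul_eq']
  simp

variable (k A m) in
/-- The linear map with given entries. -/
noncomputable def ofEntries :
    ((Fin (m + 1) → A) × (Fin m → DualBimodule k A)) →ₗ[k] ReplicatedAlgebra k A m where
  toFun x := ⟨x.1, x.2⟩
  map_add' _ _ := rfl
  map_smul' c x := by ext <;> simp

instance [IsArtinianRing k] [Module.Finite k A] : Module.Finite k (ReplicatedAlgebra k A m) :=
  Module.Finite.of_surjective (ofEntries k A m) fun r => ⟨(r.diag, r.sub), rfl⟩

instance [IsArtinianRing k] [Module.Finite k A] :
    Module.Finite k (ReplicatedAlgebra k A m)ᵐᵒᵖ :=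
  Module.Finite.equiv (opLinearEquiv k)

theorem isArtinianRing_op [IsArtinianRing k] [Module.Finite k A] :
    IsArtinianRing (ReplicatedAlgebra k A m)ᵐᵒᵖ :=
  IsArtinianRing.of_finite k _

variable (k A) in
/-- The idempotent at the position `(i, i)`. -/
noncomputable def idem (i : Fin (m + 1)) : ReplicatedAlgebra k A m := ⟨Pi.single i 1, 0⟩

variable (k) in
/-- The element with a single entry at the position `(i, i)`. -/
noncomputable def diagSingle (i : Fin (m + 1)) : A →ₗ[k] ReplicatedAlgebra k A m where
  toFun a := ⟨Pi.single i a, 0⟩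
  map_add' a b := by ext <;> simp [Pi.single_add]
  map_smul' c a := by ext <;> simp [Pi.single_smul]

/-- The element with a single entry at the position `(i + 1, i)`. -/
noncomputable def subSingle (i : Fin m) : DualBimodule k A →ₗ[k] ReplicatedAlgebra k A m where
  toFun φ := ⟨0, Pi.single i φ⟩
  map_add' a b := by ext <;> simp [Pi.single_add]
  map_smul' c a := by ext <;> simp [Pi.single_smul]

theorem sum_idem : ∑ i, idem (m := m) k A i = 1 := by
  have h : ∀ s : Finset (Fin (m + 1)), (∑ i ∈ s, idem k A i).sub = 0 ∧
      (∑ i ∈ s, idem k A i).diag = ∑ i ∈ s, Pi.single i 1 := fun s => by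
    classical
    induction s using Finset.induction_on with
    | empty => simp
    | insert i s hi ih =>
      rw [Finset.sum_insert hi, Finset.sum_insert hi, sub_add, diag_add, ih.1, ih.2]
      exact ⟨add_zero _, rfl⟩
  ext i : 2
  · rw [(h _).2, Finset.univ_sum_single]
    rfl
  · rw [(h _).1]
    rfl

theorem mul_idem_last (r : ReplicatedAlgebra k A m) :
    r * idem k A (Fin.last m) = diagSingle k (Fin.last m) (r.diag (Fin.last m)) := by
  ext i : 2
  · by_cases hi : i = Fin.last m
    · subst hi; simp [idem, diagSingle]
    · simp [idem, diagSingle, hi]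
  · have : i.castSucc ≠ Fin.last m := Fin.castSucc_ne_last i
    simp [idem, diagSingle, this]

theorem mul_idem_castSucc (r : ReplicatedAlgebra k A m) (j : Fin m) :
    r * idem k A j.castSucc = diagSingle k j.castSucc (r.diag j.castSucc) +
      subSingle j (r.sub j) := by
  ext i : 2
  · by_cases hi : i = j.castSucc
    · subst hi; simp [idem, diagSingle, subSingle]
    · simp [idem, diagSingle, subSingle, hi]
  · by_cases hi : i = j
    · subst hi; simp [idem, diagSingle, subSingle]
    · simp [idem, diagSingle, subSingle, hi]

/-- The right module given by the row with number `i + 1`. -/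
def Row (k A : Type u) [CommRing k] [Ring A] [Algebra k A] {m : ℕ} (_i : Fin m) : Type u :=
  DualBimodule k A × A

namespace Row

variable {i : Fin m}

noncomputable instance : AddCommGroup (Row k A i) :=
  inferInstanceAs (AddCommGroup (DualBimodule k A × A))

noncomputable instance : SMul (ReplicatedAlgebra k A m)ᵐᵒᵖ (Row k A i) where
  smul r x := (op (r.unop.diag i.castSucc) • x.1 + x.2 • r.unop.sub i, x.2 * r.unop.diag i.succ)

@[ext] theorem ext {x y : Row k A i} (h1 : x.1 = y.1) (h2 : x.2 = y.2) : x = y := Prod.ext h1 h2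

@[simp] theorem fst_add (x y : Row k A i) : (x + y).1 = x.1 + y.1 := rfl
@[simp] theorem snd_add (x y : Row k A i) : (x + y).2 = x.2 + y.2 := rfl
@[simp] theorem fst_zero : (0 : Row k A i).1 = 0 := rfl
@[simp] theorem snd_zero : (0 : Row k A i).2 = 0 := rfl
@[simp] theorem fst_smul (r : (ReplicatedAlgebra k A m)ᵐᵒᵖ) (x : Row k A i) :
    (r • x).1 = op (r.unop.diag i.castSucc) • x.1 + x.2 • r.unop.sub i := rfl
@[simp] theorem snd_smul (r : (ReplicatedAlgebra k A m)ᵐᵒᵖ) (x : Row k A i) :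
    (r • x).2 = x.2 * r.unop.diag i.succ := rfl

noncomputable instance : Module (ReplicatedAlgebra k A m)ᵐᵒᵖ (Row k A i) where
  one_smul x := by ext <;> simp
  mul_smul r s x := by
    ext
    · simp [mul_assoc, add_comm, add_left_comm]
    · simp [mul_assoc]
  smul_zero r := by ext <;> simp
  smul_add r x y := by ext <;> simp [add_mul, mul_add, add_assoc, add_left_comm]
  add_smul r s x := by ext <;> simp [add_mul, mul_add, add_assoc, add_left_comm]
  zero_smul x := by ext <;> simp

variable (k A i) in
/-- The functional evaluating the entry in `DA` at the unit. -/
noncomputable def evalOne : Row k A i →+ DualizingModule k where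
  toFun x := x.1.eval 1
  map_zero' := rfl
  map_add' _ _ := rfl

theorem evalOne_op_smul (r : ReplicatedAlgebra k A m) (x : Row k A i) :
    evalOne k A i (op r • x) = x.1.eval (r.diag i.castSucc) + (r.sub i).eval x.2 := by
  change (op (r.diag i.castSucc) • x.1 + x.2 • r.sub i).eval 1 = _
  rw [DualBimodule.eval_add, DualBimodule.eval_op_smul, DualBimodule.eval_smul, mul_one, one_mul,
    unop_op]

theorem evalOne_apply (x : Row k A i) : evalOne k A i x = x.1.eval 1 := rfl

variable [IsArtinianRing k] [Module.Finite k A]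

theorem isDualOfLeftIdeal :
    IsDualOfLeftIdeal (k := k) (idem k A i.castSucc) (evalOne k A i) where
  smul c x := by
    rw [evalOne_op_smul, diag_algebraMap, sub_algebraMap, Algebra.algebraMap_eq_smul_one,
      DualBimodule.eval_smul_right]
    rw [Pi.zero_apply, DualBimodule.eval_zero, add_zero, evalOne_apply]
  idem x := by
    rw [evalOne_op_smul, evalOne_apply]
    simp [idem]
  ext x h := by
    ext y
    · simpa [evalOne_op_smul, diagSingle] using h (diagSingle k i.castSucc y)
    · refine DualBimodule.eq_zero_of_eval (k := k) fun φ => ?_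
      simpa [evalOne_op_smul, subSingle] using h (subSingle i φ)
  exists_eq Λ := by
    -- By biduality, the restriction of `Λ` to the entry in `DA` is evaluation at some `a`; this is
    -- the `A`-entry of the row.
    obtain ⟨a, ha⟩ := DualBimodule.exists_eval_eq (Λ ∘ₗ subSingle i)
    let x : Row k A i := (DualBimodule.ofHom (Λ ∘ₗ diagSingle k i.castSucc), a)
    refine ⟨x, fun r => ?_⟩
    rw [evalOne_op_smul, mul_idem_castSucc, map_add, ← ha]
    rfl

theorem injective : Module.Injective (ReplicatedAlgebra k A m)ᵐᵒᵖ (Row k A i) :=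
  isDualOfLeftIdeal.injective (DualBimodule.injective_dualizingModule k)

end Row

/-- The decomposition of the right regular module into rows. -/
noncomputable def rowEquiv : ReplicatedAlgebra k A m ≃ₗ[(ReplicatedAlgebra k A m)ᵐᵒᵖ]
    (AtCopy k A m 0 A × ∀ i : Fin m, Row k A i) where
  toFun r := (r.diag 0, fun i => (r.sub i, r.diag i.succ))
  map_add' _ _ := rfl
  map_smul' _ _ := Prod.ext rfl (funext fun _ => Prod.ext (add_comm _ _) rfl)
  invFun x := ⟨Fin.cons x.1 fun i => (x.2 i).2, fun i => (x.2 i).1⟩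
  left_inv r := ReplicatedAlgebra.ext (Fin.cons_self_tail r.diag) rfl
  right_inv _ := rfl

theorem isModuleRetract_row (i : Fin m) : IsModuleRetract (ReplicatedAlgebra k A m)ᵐᵒᵖ
    (Row k A i) (ReplicatedAlgebra k A m) := by
  refine IsModuleRetract.trans ?_ rowEquiv.symm.isModuleRetract
  exact ⟨LinearMap.inr _ _ _ ∘ₗ LinearMap.single _ (fun i => Row k A i) i,
    LinearMap.proj i ∘ₗ LinearMap.snd _ _ _, LinearMap.ext fun x => by simp⟩

theorem isModuleRetract_atCopy_zero : IsModuleRetract (ReplicatedAlgebra k A m)ᵐᵒᵖ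
    (AtCopy k A m 0 A) (ReplicatedAlgebra k A m) :=
  IsModuleRetract.trans ⟨LinearMap.inl _ _ _, LinearMap.fst _ _ _, rfl⟩
    rowEquiv.symm.isModuleRetract

instance : Module.Projective (ReplicatedAlgebra k A m)ᵐᵒᵖ (AtCopy k A m 0 A) :=
  isModuleRetract_atCopy_zero.projective

instance (i : Fin m) : Module.Projective (ReplicatedAlgebra k A m)ᵐᵒᵖ (Row k A i) :=
  (isModuleRetract_row i).projective

variable (k A m) in
/-- Evaluation at the unit on the last copy of `DA`. -/
noncomputable def lastEvalOne :
    AtCopy k A m (Fin.last m) (DualBimodule k A) →+ DualizingModule k :=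
  DualBimodule.evalOne k A

theorem isDualOfLeftIdeal_last :
    IsDualOfLeftIdeal (k := k) (idem k A (Fin.last m)) (lastEvalOne k A m) where
  smul c φ := (DualBimodule.isDualOfLeftIdeal (A := A)).smul c φ
  idem φ := by
    have h : ∀ ψ : DualBimodule k A, op ((idem k A (Fin.last m)).diag (Fin.last m)) • ψ = ψ :=
      fun ψ => by simp [idem]
    exact congrArg (DualBimodule.evalOne k A) (h φ)
  ext φ h := (DualBimodule.isDualOfLeftIdeal (A := A)).ext φ fun a => by
    have h1 : op ((diagSingle k (Fin.last m) a).diag (Fin.last m)) = op a := by simp [diagSingle]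
    rw [← h1]
    exact h (diagSingle k (Fin.last m) a)
  exists_eq Λ := by
    obtain ⟨φ, hφ⟩ := (DualBimodule.isDualOfLeftIdeal (A := A)).exists_eq
      (Λ ∘ₗ diagSingle k (Fin.last m))
    refine ⟨φ, fun r => ?_⟩
    rw [mul_idem_last]
    refine (hφ (r.diag (Fin.last m))).trans ?_
    rw [mul_one]
    rfl

section Artin

variable [IsArtinianRing k] [Module.Finite k A]

/-- A finitely generated injective module is a direct summand of a sum of the duals of the left
ideals given by the columns. -/
theorem exists_retract_of_injective (X : Type u) [AddCommGroup X]
    [Module (ReplicatedAlgebra k A m)ᵐᵒᵖ X] [Module.Finite (ReplicatedAlgebra k A m)ᵐᵒᵖ X]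
    (hX : Module.Injective (ReplicatedAlgebra k A m)ᵐᵒᵖ X) :
    InAdd (ReplicatedAlgebra k A m)ᵐᵒᵖ
      (AtCopy k A m (Fin.last m) (DualBimodule k A) × ∀ i : Fin m, Row k A i) X := by
  let _ : Module k X := Module.compHom X (algebraMap k (ReplicatedAlgebra k A m)ᵐᵒᵖ)
  have hk : ∀ (c : k) (x : X), c • x = algebraMap k (ReplicatedAlgebra k A m)ᵐᵒᵖ c • x :=
    fun _ _ => rfl
  have : IsScalarTower k (ReplicatedAlgebra k A m)ᵐᵒᵖ X :=
    ⟨fun c a x => by rw [hk, Algebra.smul_def, mul_smul]⟩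
  have : Module.Finite k X := Module.Finite.trans (ReplicatedAlgebra k A m)ᵐᵒᵖ X
  obtain ⟨n, l, hl⟩ := (DualizingModule.exists_envelope k).choose_spec.exists_separating X
  choose a ha using fun j => (isDualOfLeftIdeal_last (k := k) (A := A) (m := m)).exists_lift
    (l j).toAddMonoidHom fun c x => (l j).map_smul c x
  choose b hb using fun j i => (Row.isDualOfLeftIdeal (k := k) (A := A) (i := i)).exists_lift
    (l j).toAddMonoidHom fun c x => (l j).map_smul c x
  let F := LinearMap.pi fun j => (a j).prod (LinearMap.pi (b j))
  have hF : Function.Injective F := by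
    rw [← LinearMap.ker_eq_bot, LinearMap.ker_eq_bot']
    refine fun x hx => hl x fun j => ?_
    have hlast : a j x = 0 := congrArg Prod.fst (congrFun hx j)
    have hrow : ∀ i, b j i x = 0 := fun i => congrFun (congrArg Prod.snd (congrFun hx j)) i
    have hidem : ∀ i, l j (op (idem k A i) • x) = 0 := fun i => by
      refine Fin.lastCases ?_ (fun i => ?_) i
      · exact (ha j x).symm.trans (by rw [hlast, map_zero])
      · exact (hb j i x).symm.trans (by rw [hrow, map_zero])
    -- Since the idempotents sum to `1`, a functional vanishing on every `x e_i` vanishes at `x`.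
    rw [← one_smul (ReplicatedAlgebra k A m)ᵐᵒᵖ x, ← op_one, ← sum_idem, ← opAddEquiv_apply,
      map_sum, Finset.sum_smul, map_sum]
    exact Finset.sum_eq_zero fun i _ => hidem i
  obtain ⟨r, hr⟩ := hX.out F hF LinearMap.id
  exact ⟨n, F, r, LinearMap.ext hr⟩

variable {M : Type u} [AddCommGroup M] [Module (ReplicatedAlgebra k A m)ᵐᵒᵖ M]

/-- Rows are both projective and injective, so an indecomposable summand of a row is a summand of
`SumProjInj`. -/
theorem isGeneratorCogenerator_of_isModuleRetract
    (hM : Module.Finite (ReplicatedAlgebra k A m)ᵐᵒᵖ M)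
    (hzero : IsModuleRetract (ReplicatedAlgebra k A m)ᵐᵒᵖ (AtCopy k A m 0 A) M)
    (hlast : IsModuleRetract (ReplicatedAlgebra k A m)ᵐᵒᵖ
      (AtCopy k A m (Fin.last m) (DualBimodule k A)) M)
    (hP : IsModuleRetract (ReplicatedAlgebra k A m)ᵐᵒᵖ (SumProjInj (ReplicatedAlgebra k A m)) M) :
    IsGeneratorCogenerator (ReplicatedAlgebra k A m) M where
  finite := hM
  generator X _ _ hX hind hproj := by
    have := isArtinianRing_op (k := k) (A := A) (m := m)
    have := isLocalRing_end hind
    rcases ((inAdd_self_of_projective X).isModuleRetract.trans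
      (rowEquiv (k := k) (A := A) (m := m)).isModuleRetract).of_prod with h | ⟨i, r, h⟩
    · exact (h.trans hzero).inAdd
    · obtain ⟨j, h⟩ := isModuleRetract_of_pi i r h
      exact ((isModuleRetract_sumProjInj X hind hproj (h.injective Row.injective)).trans hP).inAdd
  cogenerator X _ _ hX hind hinj := by
    have := isArtinianRing_op (k := k) (A := A) (m := m)
    have := isLocalRing_end hind
    rcases (exists_retract_of_injective X hinj).isModuleRetract.of_prod with h | ⟨i, r, h⟩
    · exact (h.trans hlast).inAdd
    · obtain ⟨j, h⟩ := isModuleRetract_of_pi i r h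
      exact ((isModuleRetract_sumProjInj X hind h.projective hinj).trans hP).inAdd

end Artin

end ReplicatedAlgebra

end Replicated

/-! ### Transfer from `A`-modules to modules over the replicated algebra. -/

section AtCopy

variable {k A : Type u} [CommRing k] [Ring A] [Algebra k A] {m : ℕ} {i j : Fin (m + 1)}
  {X Y : Type u} [AddCommGroup X] [Module Aᵐᵒᵖ X] [AddCommGroup Y] [Module Aᵐᵒᵖ Y]

namespace AtCopy

variable (k m i) in
/-- An `A`-linear map, regarded as linear over the replicated algebra. -/
def map (f : X →ₗ[Aᵐᵒᵖ] Y) :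
    AtCopy k A m i X →ₗ[(ReplicatedAlgebra k A m)ᵐᵒᵖ] AtCopy k A m i Y where
  toFun := f
  map_add' := f.map_add
  map_smul' r x := f.map_smul (op (r.unop.diag i)) x

/-- A map linear over the replicated algebra, regarded as an `A`-linear map. -/
noncomputable def unmap (f : AtCopy k A m i X →ₗ[(ReplicatedAlgebra k A m)ᵐᵒᵖ] AtCopy k A m j Y) :
    X →ₗ[Aᵐᵒᵖ] Y where
  toFun := f
  map_add' := f.map_add
  -- The matrix with constant diagonal `a` acts as `a` on every copy, so `i` and `j` may differ.
  map_smul' a x := f.map_smul (op (⟨fun _ => a.unop, 0⟩ : ReplicatedAlgebra k A m)) x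

instance : Module.Finite (ReplicatedAlgebra k A m)ᵐᵒᵖ (AtCopy k A m i A) :=
  Module.Finite.of_surjective (M := ReplicatedAlgebra k A m)
    ({ toFun := fun r => r.diag i
       map_add' := fun _ _ => rfl
       map_smul' := fun _ _ => rfl } :
      ReplicatedAlgebra k A m →ₗ[(ReplicatedAlgebra k A m)ᵐᵒᵖ] AtCopy k A m i A)
    fun a => ⟨⟨fun _ => a, 0⟩, rfl⟩

instance [Module.Finite Aᵐᵒᵖ X] :
    Module.Finite (ReplicatedAlgebra k A m)ᵐᵒᵖ (AtCopy k A m i X) := by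
  obtain ⟨n, g, hg⟩ := exists_surjective_fin_right (R := A) X
  exact Module.Finite.of_surjective (M := Fin n → AtCopy k A m i A)
    ({ toFun := g
       map_add' := g.map_add
       map_smul' := fun r x => g.map_smul (op (r.unop.diag i)) x } :
      (Fin n → AtCopy k A m i A) →ₗ[(ReplicatedAlgebra k A m)ᵐᵒᵖ] AtCopy k A m i X) hg

theorem isNonsplitSelfExtension {u : X →ₗ[Aᵐᵒᵖ] Y} {v : Y →ₗ[Aᵐᵒᵖ] X}
    (h : IsNonsplitSelfExtension u v) : IsNonsplitSelfExtension (map k m i u) (map k m i v) where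
  nontrivial := h.nontrivial
  isUnit f hf := (Module.End.isUnit_iff f).2 <| (Module.End.isUnit_iff (unmap f)).1 <|
    h.isUnit (unmap f) fun h0 => hf (LinearMap.ext fun x => LinearMap.congr_fun h0 x)
  injective := h.injective
  exact := h.exact
  surjective := h.surjective
  nonsplit := fun ⟨s, hs⟩ => h.nonsplit ⟨unmap s, LinearMap.ext fun x => LinearMap.congr_fun hs x⟩

theorem generatesHom {r : ℕ} {f : Fin r → (X →ₗ[Aᵐᵒᵖ] Y)} (h : GeneratesHom r f) :
    GeneratesHom r fun l => map k m i (f l) := fun φ => by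
  obtain ⟨t, ht⟩ := h (unmap φ)
  refine ⟨fun l => map k m i (t l), LinearMap.ext fun x => ?_⟩
  exact (LinearMap.congr_fun ht x).trans
    ((LinearMap.sum_apply Finset.univ (fun l => f l ∘ₗ t l) (show X from x)).trans
      (LinearMap.sum_apply Finset.univ (fun l => map k m i (f l) ∘ₗ map k m i (t l)) x).symm)

/-- The algebra acts on `X^n` through `A`, so `U` is an `A`-submodule, finitely generated by
noetherianity; heredity makes the kernel of a surjection `A^l → U` projective. -/
theorem exists_resolution (hered : IsHereditaryRing A) [IsNoetherianRing Aᵐᵒᵖ]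
    [Module.Finite Aᵐᵒᵖ X] (n : ℕ)
    (U : Submodule (ReplicatedAlgebra k A m)ᵐᵒᵖ (Fin n → AtCopy k A m i X)) :
    ∃ (l : ℕ) (q : (Fin l → AtCopy k A m i A) →ₗ[(ReplicatedAlgebra k A m)ᵐᵒᵖ] U),
      Function.Surjective q ∧
        InAdd (ReplicatedAlgebra k A m)ᵐᵒᵖ (AtCopy k A m i A) (LinearMap.ker q) := by
  let V : Submodule Aᵐᵒᵖ (Fin n → X) :=
    { carrier := {x : Fin n → X | (show Fin n → AtCopy k A m i X from x) ∈ U}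
      add_mem' := U.add_mem
      zero_mem' := U.zero_mem
      smul_mem' := fun a x hx =>
        U.smul_mem (op (⟨fun _ => a.unop, 0⟩ : ReplicatedAlgebra k A m)) hx }
  obtain ⟨l, g, hg⟩ := exists_surjective_fin_right (R := A) V
  have := hered.projective_submodule l (LinearMap.ker g)
  have : IsNoetherian Aᵐᵒᵖ (Fin l → A) := inferInstance
  obtain ⟨n', a, b, hab⟩ := inAdd_self_of_projective (R := A) (LinearMap.ker g)
  let q : (Fin l → AtCopy k A m i A) →ₗ[(ReplicatedAlgebra k A m)ᵐᵒᵖ] U :=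
    { toFun := fun x => ⟨(g x).1, (g x).2⟩
      map_add' := fun x y => Subtype.ext (congrArg Subtype.val (g.map_add x y))
      map_smul' := fun r x => Subtype.ext
        (congrArg Subtype.val (g.map_smul (op (r.unop.diag i)) x)) }
  have hq : ∀ x : Fin l → A, q x = 0 ↔ g x = 0 := fun x =>
    Subtype.ext_iff.trans Subtype.ext_iff.symm
  let a' : LinearMap.ker q →ₗ[(ReplicatedAlgebra k A m)ᵐᵒᵖ] (Fin n' → AtCopy k A m i A) :=
    { toFun := fun x => a ⟨x.1, (hq x.1).1 x.2⟩
      map_add' := fun x y => a.map_add ⟨x.1, (hq x.1).1 x.2⟩ ⟨y.1, (hq y.1).1 y.2⟩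
      map_smul' := fun r x => a.map_smul (op (r.unop.diag i)) ⟨x.1, (hq x.1).1 x.2⟩ }
  let b' : (Fin n' → AtCopy k A m i A) →ₗ[(ReplicatedAlgebra k A m)ᵐᵒᵖ] LinearMap.ker q :=
    { toFun := fun x => ⟨(b x).1, (hq (b x).1).2 (b x).2⟩
      map_add' := fun x y => Subtype.ext (congrArg Subtype.val (b.map_add x y))
      map_smul' := fun r x => Subtype.ext
        (congrArg Subtype.val (b.map_smul (op (r.unop.diag i)) x)) }
  refine ⟨l, q, fun x => ?_, n', a', b', LinearMap.ext fun x => Subtype.ext ?_⟩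
  · obtain ⟨y, hy⟩ := hg ⟨x.1, x.2⟩
    exact ⟨y, Subtype.ext (congrArg Subtype.val hy)⟩
  · exact congrArg Subtype.val (LinearMap.congr_fun hab ⟨x.1, (hq x.1).1 x.2⟩)

end AtCopy

end AtCopy

/-! ### The main theorem. -/

theorem lemma4p8 (k A : Type u) [CommRing k] [Ring A] [Algebra k A]
    (hA : IsArtinAlgebra k A) (hered : IsHereditaryRing A) (m : ℕ)
    (N N' : Type u) [AddCommGroup N] [Module Aᵐᵒᵖ N] [AddCommGroup N'] [Module Aᵐᵒᵖ N']
    (hN_fin : Module.Finite Aᵐᵒᵖ N) (hN_indec : IsIndecomposableModule Aᵐᵒᵖ N)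
    (hN_div : ∀ f : Module.End Aᵐᵒᵖ N, f ≠ 0 → IsUnit f)
    (u : N →ₗ[Aᵐᵒᵖ] N') (v : N' →ₗ[Aᵐᵒᵖ] N)
    (hu : Function.Injective u) (huv : Function.Exact u v) (hv : Function.Surjective v)
    (hsplit : ¬ ∃ s : N →ₗ[Aᵐᵒᵖ] N', v ∘ₗ s = LinearMap.id) :
    IsGeneratorCogenerator (ReplicatedAlgebra k A m) (ExtensionModule k A m N') ∧
      globalDimension
        (Module.End (ReplicatedAlgebra k A m)ᵐᵒᵖ (ExtensionModule k A m N')) = ⊤ := by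
  have := hA.isArtinianRing
  have := hA.finite
  have : Module.Finite k Aᵐᵒᵖ := Module.Finite.equiv (opLinearEquiv k)
  have : IsNoetherianRing Aᵐᵒᵖ := IsNoetherianRing.of_finite k _
  have := ReplicatedAlgebra.isArtinianRing_op (k := k) (A := A) (m := m)
  have hext : IsNonsplitSelfExtension u v := ⟨hN_indec.1, hN_div, hu, huv, hv, hsplit⟩
  have : IsNoetherian Aᵐᵒᵖ N' := isNoetherian_of_range_eq_ker u v huv.linearMap_ker_eq.symm
  have := finite_sumProjInj (R := ReplicatedAlgebra k A m)
  refine ⟨ReplicatedAlgebra.isGeneratorCogenerator_of_isModuleRetract inferInstance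
    ⟨LinearMap.inl _ _ _, LinearMap.fst _ _ _, rfl⟩
    ⟨LinearMap.inr _ _ _ ∘ₗ LinearMap.inl _ _ _, LinearMap.fst _ _ _ ∘ₗ LinearMap.snd _ _ _, rfl⟩
    ⟨LinearMap.inr _ _ _ ∘ₗ LinearMap.inr _ _ _ ∘ₗ LinearMap.inl _ _ _,
      LinearMap.fst _ _ _ ∘ₗ LinearMap.snd _ _ _ ∘ₗ LinearMap.snd _ _ _, rfl⟩, ?_⟩
  have hpd := (AtCopy.isNonsplitSelfExtension (k := k) (m := m) (i := 0)
    hext).projectiveDimension_homFrom (C := AtCopy k A m 0 A)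
    (Z := AtCopy k A m (Fin.last m) (DualBimodule k A)) (P := SumProjInj (ReplicatedAlgebra k A m))
    (fun φ => LinearMap.ext fun x => LinearMap.congr_fun
      (hext.hom_eq_zero_of_injective hered (DualBimodule.injective k A) (AtCopy.unmap φ)) x)
    (by
      obtain ⟨r, f, hf⟩ := exists_generatesHom (A := A) k N' N
      exact ⟨r, _, AtCopy.generatesHom hf⟩)
    (AtCopy.exists_resolution hered)
  exact top_le_iff.1 ((Eq.ge hpd).trans (le_iSup (fun X : ModuleCat.{u} (Module.End
    (ReplicatedAlgebra k A m)ᵐᵒᵖ (ExtensionModule k A m N'))ᵐᵒᵖ =>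
      CategoryTheory.projectiveDimension X) _))
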